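/- Let $D(3,3,4)=\langle k,l \mid k^3,\ l^3,\ (kl)^4\rangle$. Let $X$ denote the variety of characters $X(D(3,3,4),\mathrm{SL}(3,\mathbb{C}))$: its points are the characters $\chi_\rho(\gamma)=\operatorname{tr}\rho(\gamma)$ of the representations $\rho\colon D(3,3,4)\to \mathrm{SL}(3,\mathbb{C})$, its regular functions are the polynomials in the trace functions $\chi\mapsto\chi(\gamma)$, $\gamma\in D(3,3,4)$, and it carries the corresponding Zariski topology. Let $X^{irr}\subset X$ be the set of characters of irreducible representations (irreducible characters), and let $\overline{X^{irr}}$ be its Zariski closure in $X$. Then $\overline{X^{irr}}$ is the disjoint union of an irreducible component $\mathcal{W}$ of dimension $2$ and exactly three points, each of which is isolated in $\overline{X^{irr}}$. The map $\chi\mapsto(\nu,\bar\nu,\zeta)=\bigl(\chi(k^{-1}l),\ \chi(kl^{-1}),\ \chi([k,l])\bigr)$, where $[k,l]=klk^{-1}l^{-1}$, is an isomorphism of affine algebraic sets from $\mathcal{W}$ onto the hypersurface in $\mathbb{C}^3$ given by $$\zeta^2-(\nu\bar\nu-2)\,\zeta+\nu^3+\bar\nu^3-5\nu\bar\nu+5=0,$$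 where $\nu,\bar\nu,\zeta$ are independent coordinates ($\bar\nu$ is not the complex conjugate of $\nu$). For every $\chi\in\mathcal{W}$ one has $\chi(k^{\pm1})=\chi(l^{\pm1})=0$ and $\chi((kl)^{\pm1})=1$. Moreover, all characters in $\mathcal{W}$ are irreducible except for the three points $(\nu,\bar\nu,\zeta)=(2,2,1)$, $(2\varpi,2\varpi^2,1)$, $(2\varpi^2,2\varpi,1)$, where $\varpi=e^{2\pi i/3}$; these three points lie on the hypersurface and the corresponding characters are not irreducible. -/

import Mathlib

/-! ### Triangle groups -/

/-- The relators `k ^ p`, `l ^ q`, `(k * l) ^ r`; the two free generators `k` and `l` are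
indexed by `0` and `1`. -/
def triangleRelators (p q r : ℕ) : Set (FreeGroup (Fin 2)) :=
  {FreeGroup.of 0 ^ p, FreeGroup.of 1 ^ q, (FreeGroup.of 0 * FreeGroup.of 1) ^ r}

/-- The triangle group `D(p, q, r) = ⟨k, l ∣ k ^ p, l ^ q, (k l) ^ r⟩`. -/
abbrev TriangleGroup (p q r : ℕ) : Type := PresentedGroup (triangleRelators p q r)

/-- The first generator `k` of `D(p, q, r)`. -/
def TriangleGroup.k (p q r : ℕ) : TriangleGroup p q r := PresentedGroup.of 0

/-- The second generator `l` of `D(p, q, r)`. -/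
def TriangleGroup.l (p q r : ℕ) : TriangleGroup p q r := PresentedGroup.of 1

/-! ### Affine algebraic sets -/

/-- The affine space `ℂ ^ ι` (the index set `ι` may be infinite), to be given the Zariski
topology. -/
def ZariskiSpace (ι : Type*) : Type _ := ι → ℂ

/-- The Zariski topology on `ℂ ^ ι`, induced by the map to the prime spectrum of the polynomial
ring that sends a point to the ideal of polynomials vanishing there. -/
noncomputable instance ZariskiSpace.topologicalSpace (ι : Type*) :
    TopologicalSpace (ZariskiSpace ι) :=
  TopologicalSpace.induced
    (fun x : ZariskiSpace ι => (MvPolynomial.pointToPoint (k := ℂ) (K := ℂ) (σ := ι) x))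
    inferInstance

/-- The Zariski closed sets are the common zero sets of families of polynomials. -/
theorem ZariskiSpace.isClosed_iff {ι : Type*} {Z : Set (ZariskiSpace ι)} :
    IsClosed Z ↔ ∃ F : Set (MvPolynomial ι ℂ),
      Z = {x : ZariskiSpace ι | ∀ f ∈ F, MvPolynomial.eval x f = 0} := by
  have key : ∀ (x : ZariskiSpace ι) (F : Set (MvPolynomial ι ℂ)),
      MvPolynomial.pointToPoint (k := ℂ) (K := ℂ) (σ := ι) x ∈ PrimeSpectrum.zeroLocus F ↔
        ∀ f ∈ F, MvPolynomial.eval x f = 0 := by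
    intro x F
    rw [PrimeSpectrum.mem_zeroLocus]
    constructor
    · intro h f hf
      have h1 := MvPolynomial.mem_vanishingIdeal_iff.1 (h hf) x (Set.mem_singleton _)
      exact h1
    · intro h f hf
      refine MvPolynomial.mem_vanishingIdeal_iff.2 ?_
      intro y hy
      rw [Set.mem_singleton_iff.1 hy]
      exact h f hf
  rw [isClosed_induced_iff]
  constructor
  · rintro ⟨t, ht, rfl⟩
    obtain ⟨F, rfl⟩ := (PrimeSpectrum.isClosed_iff_zeroLocus t).1 ht
    exact ⟨F, Set.ext fun x => key x F⟩
  · rintro ⟨F, rfl⟩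
    exact ⟨PrimeSpectrum.zeroLocus F, PrimeSpectrum.isClosed_zeroLocus F,
      Set.ext fun x => key x F⟩

/-- A map between subsets of affine spaces is regular if each of its coordinates is the
restriction of a polynomial. -/
def IsRegularMap {ι κ : Type*} {S : Set (ZariskiSpace ι)} {T : Set (ZariskiSpace κ)}
    (f : S → T) : Prop :=
  ∀ j : κ, ∃ P : MvPolynomial ι ℂ, ∀ x : S, (f x : ZariskiSpace κ) j = MvPolynomial.eval x.1 P

/-- `W` is an irreducible component of `Y`: a maximal irreducible subset of `Y`. -/
def IsComponentOf {ι : Type*} (W Y : Set (ZariskiSpace ι)) : Prop :=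
  Maximal (fun S : Set (ZariskiSpace ι) => S ⊆ Y ∧ IsIrreducible S) W

/-- `x` is an isolated point of `Y` in the Zariski topology: `{x}` is open in `Y`. -/
def IsIsolatedPointOf {ι : Type*} (x : ZariskiSpace ι) (Y : Set (ZariskiSpace ι)) : Prop :=
  ∃ U : Set (ZariskiSpace ι), IsOpen U ∧ U ∩ Y = {x}

/-! ### Varieties of characters -/

/-- The character `γ ↦ tr (ρ γ)` of a representation `ρ : Γ → SL(n, ℂ)`, as a point of the affine
space `ℂ ^ Γ`, whose coordinate functions are the evaluations `χ ↦ χ γ`. -/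
def slCharacter {Γ : Type*} [Group Γ] {n : ℕ}
    (ρ : Γ →* Matrix.SpecialLinearGroup (Fin n) ℂ) : ZariskiSpace Γ :=
  fun γ => Matrix.trace (ρ γ : Matrix (Fin n) (Fin n) ℂ)

/-- A representation `ρ : Γ → SL(n, ℂ)` is irreducible if `ℂ ^ n` is nonzero and has no invariant
subspaces besides `0` and `ℂ ^ n`. -/
def IsIrreducibleRep {Γ : Type*} [Group Γ] {n : ℕ}
    (ρ : Γ →* Matrix.SpecialLinearGroup (Fin n) ℂ) : Prop :=
  0 < n ∧ ∀ V : Submodule ℂ (Fin n → ℂ),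
    (∀ γ : Γ, ∀ v ∈ V, Matrix.mulVec (ρ γ : Matrix (Fin n) (Fin n) ℂ) v ∈ V) → V = ⊥ ∨ V = ⊤

/-- The variety of characters `X(Γ, SL(n, ℂ))`: its points are the characters of the
representations `Γ → SL(n, ℂ)`, its regular functions are the polynomials in the trace functions
`χ ↦ χ γ`, and it carries the corresponding Zariski topology. -/
def characterVariety (Γ : Type*) [Group Γ] (n : ℕ) : Set (ZariskiSpace Γ) :=
  {χ | ∃ ρ : Γ →* Matrix.SpecialLinearGroup (Fin n) ℂ, slCharacter ρ = χ}

/-- The set `X^irr(Γ, SL(n, ℂ))` of characters of irreducible representations. -/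
def irreducibleCharacters (Γ : Type*) [Group Γ] (n : ℕ) : Set (ZariskiSpace Γ) :=
  {χ | ∃ ρ : Γ →* Matrix.SpecialLinearGroup (Fin n) ℂ, IsIrreducibleRep ρ ∧ slCharacter ρ = χ}

/-- The Zariski closure of `X^irr(Γ, SL(n, ℂ))` in `X(Γ, SL(n, ℂ))`. -/
def closureIrreducibleCharacters (Γ : Type*) [Group Γ] (n : ℕ) : Set (ZariskiSpace Γ) :=
  closure (irreducibleCharacters Γ n) ∩ characterVariety Γ n

/-! ### The hypersurface and the parameters -/

/-- The hypersurface `ζ² - (ν ν' - 2) ζ + ν³ + ν'³ - 5 ν ν' + 5 = 0` in `ℂ³`, with coordinates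
`(ν, ν', ζ)`; here `ν'` is an independent coordinate, not the complex conjugate of `ν`. -/
def hypersurfaceD334 : Set (ZariskiSpace (Fin 3)) :=
  {x | (x 2) ^ 2 - (x 0 * x 1 - 2) * x 2 + (x 0) ^ 3 + (x 1) ^ 3 - 5 * (x 0 * x 1) + 5 = 0}

/-- The parameters `(χ (k⁻¹ l), χ (k l⁻¹), χ [k, l])`, where `[k, l] = k l k⁻¹ l⁻¹`. -/
def parametersD334 (χ : ZariskiSpace (TriangleGroup 3 3 4)) : ZariskiSpace (Fin 3) :=
  let k := TriangleGroup.k 3 3 4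
  let l := TriangleGroup.l 3 3 4
  ![χ (k⁻¹ * l), χ (k * l⁻¹), χ (k * l * k⁻¹ * l⁻¹)]

/-! Let `ρ` be irreducible. None of `k`, `l`, `k * l` acts as a scalar: the image would then be
generated by one matrix and scalars, and an eigenvector of that matrix would be common to both
generators. By Cayley-Hamilton, order three forces `k`, `l` and their inverses to be traceless. A
non-scalar matrix of determinant one with fourth power one has eigenvalues `1, i, -i`, or else a
double eigenvalue `a`. In the second case the rank one spectral projection of `k * l` is orthogonal
to `K` and `K ^ 2` for the trace form. This makes `ρ` rigid: in a basis permuted by `K`, the product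
is `diag(a², a, a)` with `a` one of `-1, i, -i`. These are the three isolated characters
(`IsIrreducibleRep.generic_or_exceptional`).

In the generic case let `s`, `t`, `z` be the traces of `k⁻¹ l`, `k l⁻¹`, `[k, l]`. Polarized
Cayley-Hamilton gives rules that reduce every word to a combination of nineteen words, with
coefficients polynomial in `s` and `t` (`TriangleRelations.mul_mem_wordSpan`). The traces of the
nineteen words are polynomials in `s, t, z`, so these three parameters determine the character
polynomially (`exists_polynomial_slCharacter`). Reducing two further traces gives the trace of the
inverse commutator, `s t - 2 - z`, and the equation of the hypersurface. Explicit matrices realize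
every point of it (`hasTracePair_of_mem`). Hence the generic characters form a closed set isomorphic
to the hypersurface, which is irreducible of dimension two.

A reducible generic representation, or its dual, has a common eigenvector. The rules evaluated there
give `(s, t, z) = (2c, 2c², 1)` with `c ^ 3 = 1`. Conversely, at such parameters the difference of
the projections to an eigenline of `K` and to one of `L` is orthogonal to the whole image for the
trace form. Irreducibility makes that form nondegenerate, so the two projections agree and there is
a common eigenvector after all. Every reducible point has `ζ = 1`, so the irreducible characters are
dense in the component. -/

set_option linter.unusedSimpArgs false

/-! ### Identities for `3 × 3` matrices -/

section CayleyHamilton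

variable {B : Type*} [CommRing B]

/-- The Cayley-Hamilton theorem for `3 × 3` matrices. -/
theorem Matrix.cube_eq_of_fin_three (X : Matrix (Fin 3) (Fin 3) B) :
    X * (X * X) = X.trace • (X * X) - X.adjugate.trace • X + X.det • 1 := by
  ext i j
  rw [Matrix.adjugate_fin_three]
  fin_cases i <;> fin_cases j <;>
    simp [Matrix.mul_apply, Fin.sum_univ_three, Matrix.trace_fin_three, Matrix.det_fin_three] <;>
    ring

theorem Matrix.trace_mul_self_fin_three (X : Matrix (Fin 3) (Fin 3) B) :
    (X * X).trace = X.trace ^ 2 - 2 * X.adjugate.trace := by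
  rw [Matrix.adjugate_fin_three]
  simp [Matrix.mul_apply, Fin.sum_univ_three, Matrix.trace_fin_three]
  ring

/-- The polarized Cayley-Hamilton identity for `3 × 3` matrices. -/
theorem Matrix.polarized_cayleyHamilton_fin_three (X Y : Matrix (Fin 3) (Fin 3) B)
    (hX : X.trace = 0) (hX' : X.adjugate.trace = 0) (hY : Y.trace = 0) :
    X * (X * Y) + X * (Y * X) + Y * (X * X) =
      (X * Y).trace • X + (X * (X * Y)).trace • 1 := by
  have key : X * (X * Y) + X * (Y * X) + Y * (X * X) =
      X.trace • (X * Y + Y * X) + Y.trace • (X * X) - X.adjugate.trace • Y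
      - (X.trace * Y.trace - (X * Y).trace) • X
      + ((X * (X * Y)).trace - X.trace * (X * Y).trace + X.adjugate.trace * Y.trace) •
        (1 : Matrix (Fin 3) (Fin 3) B) := by
    ext i j
    rw [Matrix.adjugate_fin_three]
    fin_cases i <;> fin_cases j <;>
      simp [Matrix.mul_apply, Fin.sum_univ_three, Matrix.trace_fin_three] <;> ring
  rw [key, hX, hX', hY]
  simp

theorem Matrix.adjugate_eq_of_mul_eq_one {X Y : Matrix (Fin 3) (Fin 3) B}
    (hX : X.det = 1) (h : X * Y = 1) : X.adjugate = Y := by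
  calc X.adjugate = X.adjugate * (X * Y) := by rw [h, mul_one]
    _ = Y := by rw [← mul_assoc, Matrix.adjugate_mul, hX, one_smul, one_mul]

theorem Matrix.cube_eq_one_of_trace {X : Matrix (Fin 3) (Fin 3) B} (hX : X.det = 1)
    (h : X.trace = 0) (h' : X.adjugate.trace = 0) : X * (X * X) = 1 := by
  rw [Matrix.cube_eq_of_fin_three, h, h', hX]
  simp

/-- The characteristic polynomial is `(x - 1) * (x ^ 2 + 1)`, a divisor of `x ^ 4 - 1`. -/
theorem Matrix.pow_four_eq_one_of_trace {X : Matrix (Fin 3) (Fin 3) B} (hX : X.det = 1)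
    (h : X.trace = 1) (h' : X.adjugate.trace = 1) : X ^ 4 = 1 := by
  have h3 := Matrix.cube_eq_of_fin_three X
  rw [h, h', hX, one_smul, one_smul, one_smul] at h3
  have : X ^ 4 = X * (X * (X * X)) := by noncomm_ring
  rw [this, h3, mul_add, mul_sub, h3]
  noncomm_ring

end CayleyHamilton

/-! ### A rewriting system -/

/-- Relations that hold for two matrices `K`, `L` of order three in `SL(3)`, with inverses `k` and
`l`, such that `K * L` has order four and simple eigenvalues; `s` and `t` are the traces of
`k * L` and `K * l`. -/
structure TriangleRelations {A R : Type*} [CommRing A] [Ring R] [Algebra A R] (K k L l : R)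
    (s t : A) : Prop where
  sq : K * K = k
  mul_inv : K * k = 1
  inv_mul : k * K = 1
  inv_sq : k * k = K
  KLK : K * (L * K) = K + s • 1 - k * L - L * k
  KlK : K * (l * K) = t • K + 1 - k * l - l * k
  kLk : k * (L * k) = s • k + 1 - K * L - L * K
  klk : k * (l * k) = k + t • 1 - K * l - l * K
  kLK : k * (L * K) = k + s • K - L - K * (L * k)
  klK : k * (l * K) = t • k + K - l - K * (l * k)

namespace TriangleRelations

variable {A R : Type*} [CommRing A] [Ring R] [Algebra A R] {K k L l : R} {s t : A}

theorem sq_mul (h : TriangleRelations K k L l s t) (x : R) : K * (K * x) = k * x := by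
  simpa only [mul_assoc, one_mul] using congrArg (· * x) h.sq

theorem mul_inv_mul (h : TriangleRelations K k L l s t) (x : R) : K * (k * x) = x := by
  simpa only [mul_assoc, one_mul] using congrArg (· * x) h.mul_inv

theorem inv_mul_mul (h : TriangleRelations K k L l s t) (x : R) : k * (K * x) = x := by
  simpa only [mul_assoc, one_mul] using congrArg (· * x) h.inv_mul

theorem inv_sq_mul (h : TriangleRelations K k L l s t) (x : R) : k * (k * x) = K * x := by
  simpa only [mul_assoc, one_mul] using congrArg (· * x) h.inv_sq

theorem KLK_mul (h : TriangleRelations K k L l s t) (x : R) :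
    K * (L * (K * x)) = K * x + s • x - k * (L * x) - L * (k * x) := by
  simpa only [sub_mul, add_mul, mul_assoc, smul_mul_assoc, one_mul] using congrArg (· * x) h.KLK

theorem kLk_mul (h : TriangleRelations K k L l s t) (x : R) :
    k * (L * (k * x)) = s • (k * x) + x - K * (L * x) - L * (K * x) := by
  simpa only [sub_mul, add_mul, mul_assoc, smul_mul_assoc, one_mul] using congrArg (· * x) h.kLk

theorem kLK_mul (h : TriangleRelations K k L l s t) (x : R) :
    k * (L * (K * x)) = k * x + s • (K * x) - L * x - K * (L * (k * x)) := by
  simpa only [sub_mul, add_mul, mul_assoc, smul_mul_assoc, one_mul] using congrArg (· * x) h.kLK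

/-- The span of the words in `K` and `L` that are irreducible for the rewriting system. -/
def wordSpan (A : Type*) {R : Type*} [CommRing A] [Ring R] [Algebra A R] (K k L l : R) :
    Submodule A R :=
  Submodule.span A {1, K, k, L, l, K * L, K * l, k * L, k * l, L * K, L * k, l * K, l * k,
    K * (L * k), K * (l * k), L * (K * l), L * (k * l), K * (L * (k * l)), L * (K * (l * k))}

theorem wordSpan_comm : wordSpan A L l K k = wordSpan A K k L l := by
  unfold wordSpan
  congr 1
  ext x
  simp only [Set.mem_insert_iff, Set.mem_singleton_iff]
  tauto

/-- The rules bring `K` times each of the nineteen words back into the span. Multiplication by `L`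
follows from the symmetry `wordSpan_comm`, and multiplication by the inverses from `k = K * K` and
`l = L * L`. -/
theorem mul_mem_wordSpan (h : TriangleRelations K k L l s t) (h' : TriangleRelations L l K k t s)
    {x : R} (hx : x ∈ wordSpan A K k L l) : K * x ∈ wordSpan A K k L l := by
  have hw : ∀ w ∈ ({1, K, k, L, l, K * L, K * l, k * L, k * l, L * K, L * k, l * K, l * k,
    K * (L * k), K * (l * k), L * (K * l), L * (k * l), K * (L * (k * l)), L * (K * (l * k))} : Set R),
      w ∈ wordSpan A K k L l := fun w hw => Submodule.subset_span hw
  simp only [Set.mem_insert_iff, Set.mem_singleton_iff, forall_eq_or_imp, forall_eq] at hw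
  obtain ⟨w1, w2, w3, w4, w5, w6, w7, w8, w9, w10, w11, w12, w13, w14, w15, w16, w17, w18, w19⟩ :=
    hw
  induction hx using Submodule.span_induction with
  | zero => rw [mul_zero]; exact zero_mem _
  | add x y _ _ hx hy => rw [mul_add]; exact add_mem hx hy
  | smul a x _ hx => rw [mul_smul_comm]; exact Submodule.smul_mem _ _ hx
  | mem x hx =>
    simp only [Set.mem_insert_iff, Set.mem_singleton_iff] at hx
    rcases hx with rfl | rfl | rfl | rfl | rfl | rfl | rfl | rfl | rfl | rfl | rfl | rfl | rfl |
      rfl | rfl | rfl | rfl | rfl | rfl <;>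
    (try simp only [mul_one, mul_add, mul_sub, mul_smul_comm, smul_add, smul_sub,
      h.sq, h.sq_mul, h.mul_inv, h.mul_inv_mul, h.inv_mul, h.inv_mul_mul, h.inv_sq,
      h.inv_sq_mul, h.KLK, h.KLK_mul, h.KlK, h.kLk, h.kLk_mul, h.klk, h.kLK,
      h.kLK_mul, h.klK, h'.sq, h'.sq_mul, h'.mul_inv, h'.mul_inv_mul,
      h'.inv_mul, h'.inv_mul_mul, h'.inv_sq, h'.inv_sq_mul, h'.KLK, h'.KLK_mul, h'.KlK,
      h'.kLk, h'.kLk_mul, h'.klk, h'.kLK, h'.kLK_mul, h'.klK]) <;>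
    repeat' first
      | assumption
      | apply Submodule.add_mem
      | apply Submodule.sub_mem
      | apply Submodule.smul_mem

end TriangleRelations

/-! ### Pairs of matrices of order three whose product has simple eigenvalues -/

/-- `K` and `L` are matrices of determinant `1` with inverses `k = K ^ 2` and `l = L ^ 2`, and
`K`, `L` and `K * L` have the characteristic polynomials `x ^ 3 - 1`, `x ^ 3 - 1` and
`(x - 1) * (x ^ 2 + 1)`. -/
structure IsTracePair {B : Type*} [CommRing B] (K k L l : Matrix (Fin 3) (Fin 3) B) : Prop where
  det_left : K.det = 1
  det_right : L.det = 1
  sq_left : K * K = k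
  sq_right : L * L = l
  mul_inv_left : K * k = 1
  mul_inv_right : L * l = 1
  trace_left : K.trace = 0
  trace_left_inv : k.trace = 0
  trace_right : L.trace = 0
  trace_right_inv : l.trace = 0
  trace_mul : (K * L).trace = 1
  trace_inv_mul : (k * l).trace = 1

namespace IsTracePair

variable {B : Type*} [CommRing B] {K k L l : Matrix (Fin 3) (Fin 3) B}

theorem symm (h : IsTracePair K k L l) : IsTracePair L l K k where
  det_left := h.det_right
  det_right := h.det_left
  sq_left := h.sq_right
  sq_right := h.sq_left
  mul_inv_left := h.mul_inv_right
  mul_inv_right := h.mul_inv_left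
  trace_left := h.trace_right
  trace_left_inv := h.trace_right_inv
  trace_right := h.trace_left
  trace_right_inv := h.trace_left_inv
  trace_mul := by rw [Matrix.trace_mul_comm]; exact h.trace_mul
  trace_inv_mul := by rw [Matrix.trace_mul_comm]; exact h.trace_inv_mul

theorem inv_mul_left (h : IsTracePair K k L l) : k * K = 1 :=
  mul_eq_one_comm.1 h.mul_inv_left

theorem inv_sq_left (h : IsTracePair K k L l) : k * k = K := by
  rw [← h.sq_left, mul_assoc, h.sq_left, h.mul_inv_left, mul_one]

theorem det_left_inv (h : IsTracePair K k L l) : k.det = 1 := by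
  rw [← h.sq_left, Matrix.det_mul, h.det_left, one_mul]

theorem adjugate_left (h : IsTracePair K k L l) : K.adjugate = k :=
  Matrix.adjugate_eq_of_mul_eq_one h.det_left h.mul_inv_left

theorem adjugate_left_inv (h : IsTracePair K k L l) : k.adjugate = K :=
  Matrix.adjugate_eq_of_mul_eq_one h.det_left_inv h.inv_mul_left

/-- Polarized Cayley-Hamilton for the four pairs formed from `K` or `k` and `L` or `l` gives the
four symmetric rules; multiplying the first two by `K` on the left gives the last two. The
coefficients are taken in a ring `A` over which `B` is an algebra, so that `A` can later be the
subalgebra generated by the parameters. -/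
theorem relations (h : IsTracePair K k L l) {A : Type*} [CommRing A] [Algebra A B] {s t : A}
    (hs : algebraMap A B s = (k * L).trace) (ht : algebraMap A B t = (K * l).trace) :
    TriangleRelations K k L l s t := by
  have e1 := Matrix.polarized_cayleyHamilton_fin_three K L h.trace_left
    (by rw [h.adjugate_left]; exact h.trace_left_inv) h.trace_right
  have e2 := Matrix.polarized_cayleyHamilton_fin_three K l h.trace_left
    (by rw [h.adjugate_left]; exact h.trace_left_inv) h.trace_right_inv
  have e3 := Matrix.polarized_cayleyHamilton_fin_three k L h.trace_left_inv
    (by rw [h.adjugate_left_inv]; exact h.trace_left) h.trace_right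
  have e4 := Matrix.polarized_cayleyHamilton_fin_three k l h.trace_left_inv
    (by rw [h.adjugate_left_inv]; exact h.trace_left) h.trace_right_inv
  rw [← mul_assoc K K L, h.sq_left, h.trace_mul, ← hs, algebraMap_smul, one_smul] at e1
  rw [← mul_assoc K K l, h.sq_left, h.trace_inv_mul, ← ht, algebraMap_smul, one_smul] at e2
  rw [← mul_assoc k k L, h.inv_sq_left, h.trace_mul, ← hs, algebraMap_smul, one_smul] at e3
  rw [← mul_assoc k k l, h.inv_sq_left, h.trace_inv_mul, ← ht, algebraMap_smul, one_smul] at e4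
  have KLK : K * (L * K) = K + s • 1 - k * L - L * k := by rw [← e1]; abel
  have KlK : K * (l * K) = t • K + 1 - k * l - l * k := by rw [← e2]; abel
  have cancel : ∀ x, K * (k * x) = x := fun x => by rw [← mul_assoc, h.mul_inv_left, one_mul]
  refine ⟨h.sq_left, h.mul_inv_left, h.inv_mul_left, h.inv_sq_left, KLK, KlK,
    by rw [← e3]; abel, by rw [← e4]; abel, ?_, ?_⟩
  · rw [← h.sq_left, mul_assoc, KLK, mul_sub, mul_sub, mul_add, cancel, mul_smul_comm, mul_one]
    simp only [h.sq_left]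
  · rw [← h.sq_left, mul_assoc, KlK, mul_sub, mul_sub, mul_add, cancel, mul_smul_comm, mul_one]
    simp only [h.sq_left]

theorem trace_conj (h : IsTracePair K k L l) (X : Matrix (Fin 3) (Fin 3) B) :
    (K * (X * k)).trace = X.trace := by
  rw [Matrix.trace_mul_comm, mul_assoc, h.inv_mul_left, mul_one]

/-- The trace of the commutator and that of its inverse have a sum that is determined by the other
parameters. -/
theorem trace_commutator_add (h : IsTracePair K k L l) :
    (K * (L * (k * l))).trace + (L * (K * (l * k))).trace =
      (k * L).trace * (K * l).trace - 2 := by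
  -- The word on the right is not reduced. Bringing it to normal form produces the commutator word
  -- with coefficient `-1`, which turns the cyclic invariance of the trace into the required
  -- relation.
  have key : (L * (K * (l * k))).trace = (K * (l * (k * L))).trace := by
    rw [Matrix.trace_mul_comm]; simp only [mul_assoc]
  obtain ⟨s, hs⟩ : ∃ s, s = (k * L).trace := ⟨_, rfl⟩
  obtain ⟨t, ht⟩ : ∃ t, t = (K * l).trace := ⟨_, rfl⟩
  have hs' : s = (L * k).trace := hs.trans (Matrix.trace_mul_comm _ _)
  have ht' : t = (l * K).trace := ht.trans (Matrix.trace_mul_comm _ _)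
  have r := h.relations (A := B) hs ht
  have r' := h.symm.relations (A := B) ht' hs'
  simp only [mul_one, mul_add, mul_sub, add_mul, sub_mul, mul_smul_comm, smul_mul_assoc, smul_add,
    smul_sub, mul_assoc, r.sq, r.sq_mul, r.mul_inv, r.mul_inv_mul, r.inv_mul, r.inv_mul_mul,
    r.inv_sq, r.inv_sq_mul, r.KLK, r.KLK_mul, r.KlK, r.kLk, r.kLk_mul, r.klk,
    r.kLK, r.kLK_mul, r.klK, r'.sq, r'.sq_mul, r'.mul_inv,
    r'.mul_inv_mul, r'.inv_mul, r'.inv_mul_mul, r'.inv_sq, r'.inv_sq_mul, r'.KLK, r'.KLK_mul,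
    r'.KlK, r'.kLk, r'.kLk_mul, r'.klk, r'.kLK, r'.kLK_mul, r'.klK,
    Matrix.trace_add, Matrix.trace_sub, Matrix.trace_smul, Matrix.trace_one,
    smul_eq_mul, Fintype.card_fin] at key
  simp only [h.trace_left, h.trace_left_inv, h.trace_right, h.trace_right_inv, h.trace_mul,
    h.trace_inv_mul, h.symm.trace_mul, h.symm.trace_inv_mul, h.trace_conj, h.symm.trace_conj,
    ← hs, ← ht, ← hs', ← ht'] at key ⊢
  push_cast at key
  linear_combination key

/-- The equation between the parameters of a pair. -/
theorem trace_equation (h : IsTracePair K k L l) :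
    (K * (L * (k * l))).trace ^ 2
      - ((k * L).trace * (K * l).trace - 2) * (K * (L * (k * l))).trace
      + (k * L).trace ^ 3 + (K * l).trace ^ 3 - 5 * ((k * L).trace * (K * l).trace) + 5 = 0 := by
  have hadd := h.trace_commutator_add
  have hadj : (K * (L * (k * l))).adjugate = L * (K * (l * k)) := by
    simp only [Matrix.adjugate_mul_distrib, h.symm.adjugate_left, h.adjugate_left_inv,
      h.adjugate_left, h.symm.adjugate_left_inv, mul_assoc]
  -- For the commutator `X`, whose adjugate is its inverse, the trace of `X * X` is `z ^ 2 - 2 *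
  -- z'`, where `z'` is the trace of the inverse. Reducing `X * X` by the rules computes the same
  -- trace from `s`, `t`, `z`; comparison gives the equation.
  have key := Matrix.trace_mul_self_fin_three (K * (L * (k * l)))
  rw [hadj] at key
  obtain ⟨s, hs⟩ : ∃ s, s = (k * L).trace := ⟨_, rfl⟩
  obtain ⟨t, ht⟩ : ∃ t, t = (K * l).trace := ⟨_, rfl⟩
  have hs' : s = (L * k).trace := hs.trans (Matrix.trace_mul_comm _ _)
  have ht' : t = (l * K).trace := ht.trans (Matrix.trace_mul_comm _ _)
  have r := h.relations (A := B) hs ht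
  have r' := h.symm.relations (A := B) ht' hs'
  simp only [mul_one, mul_add, mul_sub, add_mul, sub_mul, mul_smul_comm, smul_mul_assoc, smul_add,
    smul_sub, mul_assoc, r.sq, r.sq_mul, r.mul_inv, r.mul_inv_mul, r.inv_mul, r.inv_mul_mul,
    r.inv_sq, r.inv_sq_mul, r.KLK, r.KLK_mul, r.KlK, r.kLk, r.kLk_mul, r.klk,
    r.kLK, r.kLK_mul, r.klK, r'.sq, r'.sq_mul, r'.mul_inv,
    r'.mul_inv_mul, r'.inv_mul, r'.inv_mul_mul, r'.inv_sq, r'.inv_sq_mul, r'.KLK, r'.KLK_mul,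
    r'.KlK, r'.kLk, r'.kLk_mul, r'.klk, r'.kLK, r'.kLK_mul, r'.klK,
    Matrix.trace_add, Matrix.trace_sub, Matrix.trace_smul, Matrix.trace_one,
    smul_eq_mul, Fintype.card_fin] at key
  simp only [h.trace_left, h.trace_left_inv, h.trace_right, h.trace_right_inv, h.trace_mul,
    h.trace_inv_mul, h.symm.trace_mul, h.symm.trace_inv_mul, h.trace_conj, h.symm.trace_conj,
    ← hs, ← ht, ← hs', ← ht'] at key hadd ⊢
  push_cast at key
  linear_combination -key + 2 * hadd

end IsTracePair

/-! ### Construction of pairs with given parameters -/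

namespace IsTracePair

variable {B : Type*} [CommRing B] {K k L l : Matrix (Fin 3) (Fin 3) B}

theorem of_trace (hK : K.det = 1) (hL : L.det = 1) (tK : K.trace = 0) (tK' : K.adjugate.trace = 0)
    (tL : L.trace = 0) (tL' : L.adjugate.trace = 0) (hKL : (K * L).trace = 1)
    (hKL' : ((K * K) * (L * L)).trace = 1) : IsTracePair K (K * K) L (L * L) where
  det_left := hK
  det_right := hL
  sq_left := rfl
  sq_right := rfl
  mul_inv_left := Matrix.cube_eq_one_of_trace hK tK tK'
  mul_inv_right := Matrix.cube_eq_one_of_trace hL tL tL'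
  trace_left := tK
  trace_left_inv := by rw [Matrix.trace_mul_self_fin_three, tK, tK']; ring
  trace_right := tL
  trace_right_inv := by rw [Matrix.trace_mul_self_fin_three, tL, tL']; ring
  trace_mul := hKL
  trace_inv_mul := hKL'

theorem transpose (h : IsTracePair K k L l) :
    IsTracePair K.transpose k.transpose L.transpose l.transpose where
  det_left := by rw [Matrix.det_transpose, h.det_left]
  det_right := by rw [Matrix.det_transpose, h.det_right]
  sq_left := by rw [← Matrix.transpose_mul, h.sq_left]
  sq_right := by rw [← Matrix.transpose_mul, h.sq_right]
  mul_inv_left := by rw [← Matrix.transpose_mul, h.inv_mul_left, Matrix.transpose_one]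
  mul_inv_right := by rw [← Matrix.transpose_mul, h.symm.inv_mul_left, Matrix.transpose_one]
  trace_left := by rw [Matrix.trace_transpose, h.trace_left]
  trace_left_inv := by rw [Matrix.trace_transpose, h.trace_left_inv]
  trace_right := by rw [Matrix.trace_transpose, h.trace_right]
  trace_right_inv := by rw [Matrix.trace_transpose, h.trace_right_inv]
  trace_mul := by rw [← Matrix.transpose_mul, Matrix.trace_transpose, h.symm.trace_mul]
  trace_inv_mul := by rw [← Matrix.transpose_mul, Matrix.trace_transpose, h.symm.trace_inv_mul]

end IsTracePair

/-- `(s, t, z)` are the parameters of some pair. -/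
def HasTracePair (s t z : ℂ) : Prop :=
  ∃ K k L l : Matrix (Fin 3) (Fin 3) ℂ, IsTracePair K k L l ∧ (k * L).trace = s ∧
    (K * l).trace = t ∧ (K * (L * (k * l))).trace = z

/-- Normal form in which `K` permutes the basis cyclically and the first basis vector is fixed by `K
* L`. On the quotient by that vector `K * L` has matrix `!![a, d; b, -a]`, of trace `0` and, by
`h1`, determinant `1`. The condition `h2` makes the adjugate of `L` traceless, and `h3`, `h4`
prescribe the remaining two parameters. -/
theorem hasTracePair_of_cyclic {a b d s t z : ℂ} (h1 : a ^ 2 + b * d + 1 = 0)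
    (h2 : d + b ^ 2 - a * (s - d) = 0) (h3 : b * (a - 1) + (s - d) * d = t)
    (h4 : -1 - 2 * a - b * s + d * t = z) : HasTracePair s t z := by
  refine ⟨!![0, 0, 1; 1, 0, 0; 0, 1, 0], _, !![0, a, d; 0, b, -a; 1, s - d, -b], _,
    IsTracePair.of_trace ?_ ?_ ?_ ?_ ?_ ?_ ?_ ?_, ?_, ?_, ?_⟩
  all_goals
    simp [Matrix.adjugate_fin_three, Matrix.det_fin_three, Matrix.trace_fin_three]
  · linear_combination -h1
  · linear_combination -h2
  · linear_combination -h1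
  · linear_combination h3
  · linear_combination b * h2 + a * h1 + h1 + d * h3 + h4

/-- The witnesses solve the four conditions of the cyclic normal form; their common denominator is
the expression assumed nonzero in `hD`. -/
theorem hasTracePair_of_ne_zero {s t z : ℂ}
    (h : z ^ 2 - (s * t - 2) * z + s ^ 3 + t ^ 3 - 5 * (s * t) + 5 = 0)
    (hD : s ^ 3 + t ^ 3 - 6 * (s * t) + 8 ≠ 0) : HasTracePair s t z := by
  obtain ⟨D, hDe⟩ : ∃ D, D = s ^ 3 + t ^ 3 - 6 * (s * t) + 8 := ⟨_, rfl⟩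
  rw [← hDe] at hD
  apply hasTracePair_of_cyclic
    (a := (-s ^ 3 - t ^ 3 + s * t * z + 5 * s * t - 4 * z - 4) / D)
    (b := (1 - z) * (s ^ 2 - 2 * t) / D) (d := (z - 1) * (t ^ 2 - 2 * s) / D)
  · field_simp
    rw [hDe]
    linear_combination 2 * (s ^ 3 + t ^ 3 - 6 * (s * t) + 8) * h
  · field_simp
    rw [hDe]
    linear_combination s * (s ^ 3 + t ^ 3 - 6 * (s * t) + 8) * h
  · field_simp
    rw [hDe]
    linear_combination -t * (s ^ 3 + t ^ 3 - 6 * (s * t) + 8) * h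
  · field_simp
    rw [hDe]
    ring

/-- Explicit pairs over the locus left out by the cyclic normal form, for one of the two values of
`z`. -/
theorem hasTracePair_mul_sub {c s t : ℂ} (hc : c ^ 3 = 1) (h : 2 + c ^ 2 * s + c * t = 0) :
    HasTracePair s t (s * t - 3) := by
  refine ⟨!![0, -c ^ 2, s - c; 1, -c, -1; 0, 0, c], _,
    !![-c ^ 2, 0, -2 * c ^ 2; -c, 0, -c; 0, 1, c ^ 2], _,
    IsTracePair.of_trace ?_ ?_ ?_ ?_ ?_ ?_ ?_ ?_, ?_, ?_, ?_⟩
  all_goals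
    simp [Matrix.adjugate_fin_three, Matrix.det_fin_three, Matrix.trace_fin_three]
  all_goals grind

/-- Transposition keeps `s` and `t` and replaces the commutator by a matrix with the trace of its
inverse, which is the other root of the quadratic equation for `z`. -/
theorem IsTracePair.hasTracePair_transpose {K k L l : Matrix (Fin 3) (Fin 3) ℂ}
    (h : IsTracePair K k L l) : HasTracePair (k * L).trace (K * l).trace
      ((k * L).trace * (K * l).trace - 2 - (K * (L * (k * l))).trace) := by
  refine ⟨_, _, _, _, h.transpose, ?_, ?_, ?_⟩
  · rw [← Matrix.transpose_mul, Matrix.trace_transpose, Matrix.trace_mul_comm]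
  · rw [← Matrix.transpose_mul, Matrix.trace_transpose, Matrix.trace_mul_comm]
  · simp only [← Matrix.transpose_mul]
    rw [Matrix.trace_transpose, ← h.trace_commutator_add, add_sub_cancel_left, mul_assoc, mul_assoc,
      Matrix.trace_mul_comm]
    simp only [mul_assoc]
    rw [Matrix.trace_mul_comm]
    simp only [mul_assoc]

theorem hasTracePair_of_mem {s t z : ℂ}
    (h : z ^ 2 - (s * t - 2) * z + s ^ 3 + t ^ 3 - 5 * (s * t) + 5 = 0) : HasTracePair s t z := by
  by_cases hD : s ^ 3 + t ^ 3 - 6 * (s * t) + 8 = 0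
  swap
  · exact hasTracePair_of_ne_zero h hD
  obtain ⟨w, hw⟩ := IsAlgClosed.exists_root (Polynomial.X ^ 2 + Polynomial.X + 1 : Polynomial ℂ)
    (by
      have : (Polynomial.X ^ 2 + Polynomial.X + 1 : Polynomial ℂ).degree = 2 := by compute_degree!
      rw [this]; decide)
  replace hw : w ^ 2 + w + 1 = 0 := by simpa using hw
  have hw3 : w ^ 3 = 1 := by linear_combination (w - 1) * hw
  -- The cubic `s ^ 3 + t ^ 3 + 2 ^ 3 - 3 * (2 * s * t)` is the product of `2 + c ^ 2 * s + c * t`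
  -- over the three cube roots of unity `c`.
  have h1 : HasTracePair s t (s * t - 3) := by
    have : (2 + 1 ^ 2 * s + 1 * t) * ((2 + w ^ 2 * s + w * t) * (2 + (w ^ 2) ^ 2 * s + w ^ 2 * t))
        = 0 := by
      rw [← hD]
      grind
    rcases mul_eq_zero.1 this with h0 | h0
    · exact hasTracePair_mul_sub (by ring) h0
    rcases mul_eq_zero.1 h0 with h0 | h0
    · exact hasTracePair_mul_sub hw3 h0
    · exact hasTracePair_mul_sub (by linear_combination (w ^ 3 + 1) * hw3) h0
  -- Where the cubic vanishes the equation for `z` splits. One root is realized explicitly, the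
  -- other by transposing.
  have hz : (z - 1) * (z - (s * t - 3)) = 0 := by linear_combination h - hD
  rcases mul_eq_zero.1 hz with h0 | h0
  · obtain ⟨K, k, L, l, hp, rfl, rfl, h3⟩ := h1
    have := hp.hasTracePair_transpose
    rw [h3] at this
    convert this using 1
    linear_combination h0
  · rwa [sub_eq_zero.1 h0]

/-! ### Representations of triangle groups -/

namespace TriangleGroup

variable {p q r : ℕ}

theorem k_pow : k p q r ^ p = 1 :=
  PresentedGroup.one_of_mem (rels := triangleRelators p q r) (Or.inl rfl)

theorem l_pow : l p q r ^ q = 1 :=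
  PresentedGroup.one_of_mem (rels := triangleRelators p q r) (Or.inr (Or.inl rfl))

theorem k_mul_l_pow : (k p q r * l p q r) ^ r = 1 :=
  PresentedGroup.one_of_mem (rels := triangleRelators p q r) (Or.inr (Or.inr rfl))

theorem induction {C : TriangleGroup p q r → Prop} (one : C 1) (k : C (k p q r))
    (k_inv : C (TriangleGroup.k p q r)⁻¹) (l : C (l p q r)) (l_inv : C (TriangleGroup.l p q r)⁻¹)
    (mul : ∀ x y, C x → C y → C (x * y)) (γ : TriangleGroup p q r) : C γ := by
  induction γ using PresentedGroup.induction_on with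
  | H z =>
    induction z using FreeGroup.induction_on with
    | C1 => rw [map_one]; exact one
    | of i => fin_cases i; exacts [k, l]
    | inv_of i _ => rw [map_inv]; fin_cases i; exacts [k_inv, l_inv]
    | mul x y hx hy => rw [map_mul]; exact mul _ _ hx hy

/-- A pair of matrices that satisfy the defining relations gives a representation. -/
theorem exists_representation {n : ℕ} {K L : Matrix (Fin n) (Fin n) ℂ} (hK : K.det = 1)
    (hL : L.det = 1) (hKp : K ^ p = 1) (hLq : L ^ q = 1) (hKL : (K * L) ^ r = 1) :
    ∃ ρ : TriangleGroup p q r →* Matrix.SpecialLinearGroup (Fin n) ℂ,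
      (ρ (k p q r) : Matrix (Fin n) (Fin n) ℂ) = K ∧
      (ρ (l p q r) : Matrix (Fin n) (Fin n) ℂ) = L := by
  let f : Fin 2 → Matrix.SpecialLinearGroup (Fin n) ℂ := ![⟨K, hK⟩, ⟨L, hL⟩]
  have hrel : ∀ x ∈ triangleRelators p q r,
      FreeGroup.lift f x = 1 := by
    rintro x (rfl | rfl | rfl) <;> apply Subtype.ext <;> simpa [f]
  refine ⟨PresentedGroup.toGroup hrel, ?_, ?_⟩
  · exact congrArg Subtype.val (PresentedGroup.toGroup.of hrel (x := 0))
  · exact congrArg Subtype.val (PresentedGroup.toGroup.of hrel (x := 1))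

end TriangleGroup

section SpecialLinear

variable {Γ : Type*} [Group Γ] {n : ℕ} (ρ : Γ →* Matrix.SpecialLinearGroup (Fin n) ℂ)

/-- The matrix of an element under a representation. -/
def repMatrix (γ : Γ) : Matrix (Fin n) (Fin n) ℂ := (ρ γ : Matrix (Fin n) (Fin n) ℂ)

theorem repMatrix_mul (x y : Γ) : repMatrix ρ (x * y) = repMatrix ρ x * repMatrix ρ y := by
  simp [repMatrix]

theorem repMatrix_one : repMatrix ρ 1 = 1 := by simp [repMatrix]

theorem det_repMatrix (x : Γ) : (repMatrix ρ x).det = 1 := (ρ x).2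

theorem repMatrix_mul_inv (x : Γ) : repMatrix ρ x * repMatrix ρ x⁻¹ = 1 := by
  rw [← repMatrix_mul, mul_inv_cancel, repMatrix_one]

theorem repMatrix_pow (x : Γ) (m : ℕ) : repMatrix ρ (x ^ m) = repMatrix ρ x ^ m := by
  simp [repMatrix]

theorem slCharacter_apply (γ : Γ) : slCharacter ρ γ = (repMatrix ρ γ).trace := rfl

end SpecialLinear

/-- The values on the generators of the characters in the two-dimensional component. -/
def HasGenericValues (χ : ZariskiSpace (TriangleGroup 3 3 4)) : Prop :=
  χ (TriangleGroup.k 3 3 4) = 0 ∧ χ (TriangleGroup.k 3 3 4)⁻¹ = 0 ∧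
  χ (TriangleGroup.l 3 3 4) = 0 ∧ χ (TriangleGroup.l 3 3 4)⁻¹ = 0 ∧
  χ (TriangleGroup.k 3 3 4 * TriangleGroup.l 3 3 4) = 1 ∧
  χ (TriangleGroup.k 3 3 4 * TriangleGroup.l 3 3 4)⁻¹ = 1

/-- The two-dimensional component of the variety of characters of `D(3, 3, 4)`. -/
def componentD334 : Set (ZariskiSpace (TriangleGroup 3 3 4)) :=
  {χ | χ ∈ characterVariety (TriangleGroup 3 3 4) 3 ∧ HasGenericValues χ}

/-! ### Generic representations of `D(3, 3, 4)` and trace pairs -/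

section D334

open TriangleGroup

theorem TriangleGroup.k_mul_k : k 3 3 4 * k 3 3 4 = (k 3 3 4)⁻¹ :=
  eq_inv_of_mul_eq_one_left (by rw [← pow_two, ← pow_succ, k_pow])

theorem TriangleGroup.l_mul_l : l 3 3 4 * l 3 3 4 = (l 3 3 4)⁻¹ :=
  eq_inv_of_mul_eq_one_left (by rw [← pow_two, ← pow_succ, l_pow])

theorem parametersD334_slCharacter (ρ : TriangleGroup 3 3 4 →* Matrix.SpecialLinearGroup (Fin 3) ℂ) :
    parametersD334 (slCharacter ρ) =
      ![(repMatrix ρ (k 3 3 4)⁻¹ * repMatrix ρ (l 3 3 4)).trace,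
        (repMatrix ρ (k 3 3 4) * repMatrix ρ (l 3 3 4)⁻¹).trace,
        (repMatrix ρ (k 3 3 4) * (repMatrix ρ (l 3 3 4) *
          (repMatrix ρ (k 3 3 4)⁻¹ * repMatrix ρ (l 3 3 4)⁻¹))).trace] := by
  simp only [parametersD334, slCharacter_apply, repMatrix_mul, mul_assoc]
  rfl

theorem isTracePair_of_hasGenericValues
    {ρ : TriangleGroup 3 3 4 →* Matrix.SpecialLinearGroup (Fin 3) ℂ}
    (h : HasGenericValues (slCharacter ρ)) :
    IsTracePair (repMatrix ρ (k 3 3 4)) (repMatrix ρ (k 3 3 4)⁻¹)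
      (repMatrix ρ (l 3 3 4)) (repMatrix ρ (l 3 3 4)⁻¹) := by
  obtain ⟨h1, h2, h3, h4, h5, h6⟩ := h
  refine ⟨det_repMatrix _ _, det_repMatrix _ _, ?_, ?_, repMatrix_mul_inv _ _, repMatrix_mul_inv _ _,
    h1, h2, h3, h4, ?_, ?_⟩
  · rw [← repMatrix_mul, k_mul_k]
  · rw [← repMatrix_mul, l_mul_l]
  · rwa [← repMatrix_mul]
  · rw [Matrix.trace_mul_comm, ← repMatrix_mul, ← mul_inv_rev]; exact h6

theorem IsTracePair.pow_four {B : Type*} [CommRing B] {K k L l : Matrix (Fin 3) (Fin 3) B}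
    (h : IsTracePair K k L l) : (K * L) ^ 4 = 1 := by
  apply Matrix.pow_four_eq_one_of_trace
  · rw [Matrix.det_mul, h.det_left, h.det_right, one_mul]
  · exact h.trace_mul
  · rw [Matrix.adjugate_mul_distrib, h.adjugate_left, h.symm.adjugate_left, h.symm.trace_inv_mul]

theorem IsTracePair.exists_representation {K k L l : Matrix (Fin 3) (Fin 3) ℂ}
    (h : IsTracePair K k L l) :
    ∃ ρ : TriangleGroup 3 3 4 →* Matrix.SpecialLinearGroup (Fin 3) ℂ,
      HasGenericValues (slCharacter ρ) ∧
      repMatrix ρ (TriangleGroup.k 3 3 4) = K ∧ repMatrix ρ (TriangleGroup.k 3 3 4)⁻¹ = k ∧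
      repMatrix ρ (TriangleGroup.l 3 3 4) = L ∧ repMatrix ρ (TriangleGroup.l 3 3 4)⁻¹ = l := by
  obtain ⟨ρ, hK, hL⟩ := TriangleGroup.exists_representation (p := 3) (q := 3) (r := 4)
    h.det_left h.det_right
    (by rw [pow_succ, pow_two, h.sq_left, h.inv_mul_left])
    (by rw [pow_succ, pow_two, h.sq_right, h.symm.inv_mul_left]) h.pow_four
  change repMatrix ρ _ = K at hK
  change repMatrix ρ _ = L at hL
  have hk : repMatrix ρ (TriangleGroup.k 3 3 4)⁻¹ = k := by
    rw [← k_mul_k, repMatrix_mul, hK, h.sq_left]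
  have hl : repMatrix ρ (TriangleGroup.l 3 3 4)⁻¹ = l := by
    rw [← l_mul_l, repMatrix_mul, hL, h.sq_right]
  refine ⟨ρ, ?_, hK, hk, hL, hl⟩
  simp only [HasGenericValues, slCharacter_apply, mul_inv_rev, repMatrix_mul, hK, hk, hL, hl]
  exact ⟨h.trace_left, h.trace_left_inv, h.trace_right, h.trace_right_inv, h.trace_mul,
    h.symm.trace_inv_mul⟩

theorem parametersD334_mem {χ : ZariskiSpace (TriangleGroup 3 3 4)} (h : χ ∈ componentD334) :
    parametersD334 χ ∈ hypersurfaceD334 := by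
  obtain ⟨⟨ρ, rfl⟩, h⟩ := h
  rw [parametersD334_slCharacter]
  exact (isTracePair_of_hasGenericValues h).trace_equation

theorem exists_mem_componentD334 {x : ZariskiSpace (Fin 3)} (hx : x ∈ hypersurfaceD334) :
    ∃ χ ∈ componentD334, parametersD334 χ = x := by
  obtain ⟨K, k, L, l, h, h1, h2, h3⟩ := hasTracePair_of_mem hx
  obtain ⟨ρ, hρ, hK, hk, hL, hl⟩ := h.exists_representation
  refine ⟨slCharacter ρ, ⟨⟨ρ, rfl⟩, hρ⟩, ?_⟩
  rw [parametersD334_slCharacter, hK, hk, hL, hl, h1, h2, h3]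
  funext i
  fin_cases i <;> rfl

end D334

/-! ### The values of the characters are polynomials in the parameters -/

section Universal

open TriangleGroup

/-- The representations with generic values on the generators. -/
def GenericRep : Type :=
  {ρ : TriangleGroup 3 3 4 →* Matrix.SpecialLinearGroup (Fin 3) ℂ //
    HasGenericValues (slCharacter ρ)}

/-- The matrices of all representations with generic values, as one matrix of functions. -/
def universalMatrix (γ : TriangleGroup 3 3 4) : Matrix (Fin 3) (Fin 3) (GenericRep → ℂ) :=
  Matrix.of fun i j ρ => repMatrix ρ.1 γ i j

theorem universalMatrix_map (γ : TriangleGroup 3 3 4) (ρ : GenericRep) :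
    (Pi.evalRingHom (fun _ => ℂ) ρ).mapMatrix (universalMatrix γ) = repMatrix ρ.1 γ := rfl

theorem matrix_ext_of_mapMatrix {M N : Matrix (Fin 3) (Fin 3) (GenericRep → ℂ)}
    (h : ∀ ρ, (Pi.evalRingHom (fun _ => ℂ) ρ).mapMatrix M =
      (Pi.evalRingHom (fun _ => ℂ) ρ).mapMatrix N) : M = N := by
  ext i j ρ
  exact congrFun (congrFun (h ρ) i) j

theorem universalMatrix_mul (x y : TriangleGroup 3 3 4) :
    universalMatrix (x * y) = universalMatrix x * universalMatrix y := by
  apply matrix_ext_of_mapMatrix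
  intro ρ
  rw [map_mul]
  simp only [universalMatrix_map, repMatrix_mul]

theorem universalMatrix_one : universalMatrix 1 = 1 := by
  apply matrix_ext_of_mapMatrix
  intro ρ
  rw [map_one, universalMatrix_map, repMatrix_one]

theorem trace_universalMatrix (γ : TriangleGroup 3 3 4) :
    (universalMatrix γ).trace = fun ρ : GenericRep => slCharacter ρ.1 γ := by
  ext ρ
  simp [Matrix.trace, universalMatrix, slCharacter_apply]

theorem det_universalMatrix (γ : TriangleGroup 3 3 4) : (universalMatrix γ).det = 1 := by
  ext ρ
  have := RingHom.map_det (Pi.evalRingHom (fun _ : GenericRep => ℂ) ρ) (universalMatrix γ)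
  rw [universalMatrix_map, det_repMatrix] at this
  exact this

/-- The identities for pairs hold over every commutative ring. Over the ring of functions on all
generic representations they treat these representations simultaneously, so the resulting
polynomials do not depend on `ρ`. -/
theorem isTracePair_universalMatrix :
    IsTracePair (universalMatrix (k 3 3 4)) (universalMatrix (k 3 3 4)⁻¹)
      (universalMatrix (l 3 3 4)) (universalMatrix (l 3 3 4)⁻¹) where
  det_left := det_universalMatrix _
  det_right := det_universalMatrix _
  sq_left := by rw [← universalMatrix_mul, k_mul_k]
  sq_right := by rw [← universalMatrix_mul, l_mul_l]
  mul_inv_left := by rw [← universalMatrix_mul, mul_inv_cancel, universalMatrix_one]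
  mul_inv_right := by rw [← universalMatrix_mul, mul_inv_cancel, universalMatrix_one]
  trace_left := by rw [trace_universalMatrix]; ext ρ; exact ρ.2.1
  trace_left_inv := by rw [trace_universalMatrix]; ext ρ; exact ρ.2.2.1
  trace_right := by rw [trace_universalMatrix]; ext ρ; exact ρ.2.2.2.1
  trace_right_inv := by rw [trace_universalMatrix]; ext ρ; exact ρ.2.2.2.2.1
  trace_mul := by
    rw [← universalMatrix_mul, trace_universalMatrix]; ext ρ; exact ρ.2.2.2.2.2.1
  trace_inv_mul := by
    rw [Matrix.trace_mul_comm, ← universalMatrix_mul, trace_universalMatrix, ← mul_inv_rev]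
    ext ρ
    exact ρ.2.2.2.2.2.2

/-- Up to cyclic permutation of factors, the nineteen words have trace `3`, `0`, `1`, `s`, `t`, `z`
or `s * t - 2 - z`. -/
theorem IsTracePair.trace_mem_of_mem_wordSpan {B : Type*} [CommRing B]
    {K k L l : Matrix (Fin 3) (Fin 3) B} (h : IsTracePair K k L l) {R : Type*} [CommRing R]
    [Algebra R B] {A : Subalgebra R B} (hs : (k * L).trace ∈ A) (ht : (K * l).trace ∈ A)
    (hz : (K * (L * (k * l))).trace ∈ A) {X : Matrix (Fin 3) (Fin 3) B}
    (hX : X ∈ TriangleRelations.wordSpan A K k L l) : X.trace ∈ A := by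
  have hs' : (L * k).trace ∈ A := by rwa [Matrix.trace_mul_comm]
  have ht' : (l * K).trace ∈ A := by rwa [Matrix.trace_mul_comm]
  have hz' : (L * (K * (l * k))).trace ∈ A := by
    rw [eq_sub_of_add_eq' h.trace_commutator_add]
    exact sub_mem (sub_mem (mul_mem hs ht) (by exact_mod_cast natCast_mem A 2)) hz
  have h0 : (0 : B) ∈ A := zero_mem A
  have h1 : (1 : B) ∈ A := one_mem A
  have h3 : (3 : B) ∈ A := by exact_mod_cast natCast_mem A 3
  induction hX using Submodule.span_induction with
  | zero => rw [Matrix.trace_zero]; exact zero_mem _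
  | add x y _ _ hx hy => rw [Matrix.trace_add]; exact add_mem hx hy
  | smul a x _ hx =>
    rw [Matrix.trace_smul]
    exact mul_mem a.2 hx
  | mem x hx =>
    simp only [Set.mem_insert_iff, Set.mem_singleton_iff] at hx
    rcases hx with rfl | rfl | rfl | rfl | rfl | rfl | rfl | rfl | rfl | rfl | rfl | rfl | rfl |
      rfl | rfl | rfl | rfl | rfl | rfl <;>
    simpa only [Matrix.trace_one, Fintype.card_fin, Nat.cast_ofNat, h.trace_left, h.trace_left_inv,
      h.trace_right, h.trace_right_inv, h.trace_mul, h.trace_inv_mul, h.symm.trace_mul,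
      h.symm.trace_inv_mul, h.trace_conj, h.symm.trace_conj]

/-- A multiplicative map whose values on the generators satisfy the relations takes its values in
the span of the irreducible words. -/
theorem TriangleRelations.map_mem_wordSpan {A R : Type*} [CommRing A] [Ring R] [Algebra A R]
    {s t : A} {F : TriangleGroup 3 3 4 → R}
    (r : TriangleRelations (F (k 3 3 4)) (F (k 3 3 4)⁻¹) (F (l 3 3 4)) (F (l 3 3 4)⁻¹) s t)
    (r' : TriangleRelations (F (l 3 3 4)) (F (l 3 3 4)⁻¹) (F (k 3 3 4)) (F (k 3 3 4)⁻¹) t s)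
    (one : F 1 = 1) (mul : ∀ x y, F (x * y) = F x * F y) (γ : TriangleGroup 3 3 4) :
    F γ ∈ wordSpan A (F (k 3 3 4)) (F (k 3 3 4)⁻¹) (F (l 3 3 4)) (F (l 3 3 4)⁻¹) := by
  set S := wordSpan A (F (k 3 3 4)) (F (k 3 3 4)⁻¹) (F (l 3 3 4)) (F (l 3 3 4)⁻¹) with hS
  have mulK : ∀ X ∈ S, F (k 3 3 4) * X ∈ S := fun X hX => r.mul_mem_wordSpan r' hX
  have mulL : ∀ X ∈ S, F (l 3 3 4) * X ∈ S := fun X hX => by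
    rw [hS, ← wordSpan_comm] at hX ⊢
    exact r'.mul_mem_wordSpan r hX
  -- Closure of the span under products is not available directly; stability under left
  -- multiplication passes from generators to products, and `X = 1` gives the claim.
  have key : ∀ X ∈ S, F γ * X ∈ S := by
    induction γ using TriangleGroup.induction with
    | one => intro X hX; rwa [one, one_mul]
    | k => exact mulK
    | l => exact mulL
    | k_inv =>
      intro X hX
      have e : F (k 3 3 4)⁻¹ * X = F (k 3 3 4) * (F (k 3 3 4) * X) := by rw [← mul_assoc, r.sq]
      rw [e]
      exact mulK _ (mulK _ hX)
    | l_inv =>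
      intro X hX
      have e : F (l 3 3 4)⁻¹ * X = F (l 3 3 4) * (F (l 3 3 4) * X) := by rw [← mul_assoc, r'.sq]
      rw [e]
      exact mulL _ (mulL _ hX)
    | mul x y hx hy =>
      intro X hX
      rw [mul, mul_assoc]
      exact hx _ (hy _ hX)
  simpa using key 1 (Submodule.subset_span (Set.mem_insert _ _))

theorem exists_polynomial_slCharacter (γ : TriangleGroup 3 3 4) :
    ∃ P : MvPolynomial (Fin 3) ℂ, ∀ ρ : TriangleGroup 3 3 4 →* Matrix.SpecialLinearGroup (Fin 3) ℂ,
      HasGenericValues (slCharacter ρ) →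
        slCharacter ρ γ = MvPolynomial.eval (parametersD334 (slCharacter ρ)) P := by
  have h := isTracePair_universalMatrix
  set K := universalMatrix (k 3 3 4)
  set k := universalMatrix (TriangleGroup.k 3 3 4)⁻¹
  set L := universalMatrix (l 3 3 4)
  set l := universalMatrix (TriangleGroup.l 3 3 4)⁻¹
  let c : Fin 3 → (GenericRep → ℂ) := fun i ρ => parametersD334 (slCharacter ρ.1) i
  -- The functions that are polynomials in the three parameters. Once the trace of `γ` is known to
  -- lie here, a preimage is the required polynomial.
  let A : Subalgebra ℂ (GenericRep → ℂ) := (MvPolynomial.aeval c : MvPolynomial (Fin 3) ℂ →ₐ[ℂ] _).range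
  have hc : ∀ i, c i ∈ A := fun i => ⟨MvPolynomial.X i, MvPolynomial.aeval_X _ _⟩
  have hs : (k * L).trace ∈ A := by
    have : (k * L).trace = c 0 := by
      rw [← universalMatrix_mul, trace_universalMatrix]
      rfl
    exact this ▸ hc 0
  have ht : (K * l).trace ∈ A := by
    have : (K * l).trace = c 1 := by
      rw [← universalMatrix_mul, trace_universalMatrix]
      rfl
    exact this ▸ hc 1
  have hz : (K * (L * (k * l))).trace ∈ A := by
    have : (K * (L * (k * l))).trace = c 2 := by
      rw [← mul_assoc, ← mul_assoc, ← universalMatrix_mul, ← universalMatrix_mul,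
        ← universalMatrix_mul, trace_universalMatrix]
      rfl
    exact this ▸ hc 2
  have r := h.relations (A := A) (s := ⟨_, hs⟩) (t := ⟨_, ht⟩) rfl rfl
  have r' := h.symm.relations (A := A) (s := ⟨_, ht⟩) (t := ⟨_, hs⟩)
    (Matrix.trace_mul_comm K l) (Matrix.trace_mul_comm k L)
  have key := r.map_mem_wordSpan r' universalMatrix_one universalMatrix_mul γ
  have hγ := h.trace_mem_of_mem_wordSpan hs ht hz key
  rw [trace_universalMatrix] at hγ
  obtain ⟨P, hP⟩ := hγ
  refine ⟨P, fun ρ hρ => ?_⟩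
  have e := MvPolynomial.comp_aeval_apply c (Pi.evalAlgHom ℂ (fun _ : GenericRep => ℂ) ⟨ρ, hρ⟩) P
  rw [MvPolynomial.aeval_eq_eval] at e
  exact (congrFun hP ⟨ρ, hρ⟩).symm.trans e

end Universal

/-! ### Irreducibility -/

section Irreducible

open Matrix

variable {Γ : Type*} [Group Γ] {ρ : Γ →* Matrix.SpecialLinearGroup (Fin 3) ℂ}

/-- A reducible representation of dimension three has a common eigenvector, or its dual has one. -/
theorem exists_common_eigenvector (h : ¬ IsIrreducibleRep ρ) :
    (∃ v : Fin 3 → ℂ, v ≠ 0 ∧ ∀ γ, ∃ c : ℂ, repMatrix ρ γ *ᵥ v = c • v) ∨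
    ∃ v : Fin 3 → ℂ, v ≠ 0 ∧ ∀ γ, ∃ c : ℂ, (repMatrix ρ γ).transpose *ᵥ v = c • v := by
  simp only [IsIrreducibleRep, not_and, not_forall, not_or] at h
  obtain ⟨V, hV, hbot, htop⟩ := h (by norm_num)
  have hlt : Module.finrank ℂ V < 3 := by
    simpa using Submodule.finrank_lt htop
  have hpos : 0 < Module.finrank ℂ V := by
    rw [Module.finrank_pos_iff]
    exact Submodule.nontrivial_iff_ne_bot.2 hbot
  obtain h1 | h2 : Module.finrank ℂ V = 1 ∨ Module.finrank ℂ V = 2 := by omega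
  · left
    obtain ⟨⟨v, hv⟩, hv0, hspan⟩ := finrank_eq_one_iff'.1 h1
    refine ⟨v, fun h => hv0 (Subtype.ext h), fun γ => ?_⟩
    obtain ⟨c, hc⟩ := hspan ⟨repMatrix ρ γ *ᵥ v, hV γ v hv⟩
    exact ⟨c, (congrArg Subtype.val hc).symm⟩
  · right
    -- An invariant plane is the kernel of a functional, which is then an eigenvector of every
    -- transposed matrix. The eigenvalue is read off at a vector `w` where the functional is `1`.
    obtain ⟨φ, hφ, hle⟩ := Submodule.exists_le_ker_of_lt_top V (lt_top_iff_ne_top.2 htop)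
    have hker : V = LinearMap.ker φ := by
      apply Submodule.eq_of_le_of_finrank_le hle
      have h3 := φ.finrank_range_add_finrank_ker
      have h4 : 0 < Module.finrank ℂ (LinearMap.range φ) := by
        rw [Module.finrank_pos_iff]
        refine Submodule.nontrivial_iff_ne_bot.2 fun h => hφ (LinearMap.range_eq_bot.1 h)
      have h5 : Module.finrank ℂ (Fin 3 → ℂ) = 3 := by simp
      omega
    have hrep : ∀ x, φ x = (fun i => φ (Pi.single i 1)) ⬝ᵥ x := by
      intro x
      rw [LinearMap.pi_apply_eq_sum_univ]
      simp only [dotProduct, smul_eq_mul]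
      refine Finset.sum_congr rfl fun i _ => ?_
      rw [mul_comm]
      congr 2
      ext j
      simp [Pi.single_apply, eq_comm]
    obtain ⟨w, hw⟩ : ∃ w, φ w = 1 := by
      obtain ⟨w, hw⟩ : ∃ w, φ w ≠ 0 := by
        by_contra! hcon
        exact hφ (LinearMap.ext hcon)
      exact ⟨(φ w)⁻¹ • w, by simp [hw]⟩
    refine ⟨fun i => φ (Pi.single i 1), ?_, fun γ => ⟨φ (repMatrix ρ γ *ᵥ w), ?_⟩⟩
    · intro h0
      rw [hrep, h0, zero_dotProduct] at hw
      exact zero_ne_one hw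
    · rw [mulVec_transpose]
      ext j
      have hmem : Pi.single j 1 - φ (Pi.single j 1) • w ∈ V := by
        rw [hker, LinearMap.mem_ker, map_sub, map_smul, hw, smul_eq_mul, mul_one, sub_self]
      have h6 := hV γ _ hmem
      change repMatrix ρ γ *ᵥ _ ∈ V at h6
      rw [hker, LinearMap.mem_ker, mulVec_sub, mulVec_smul, map_sub, map_smul, sub_eq_zero] at h6
      have h7 : ((fun i => φ (Pi.single i 1)) ᵥ* repMatrix ρ γ) j =
          φ (repMatrix ρ γ *ᵥ Pi.single j 1) := by
        rw [hrep (repMatrix ρ γ *ᵥ Pi.single j 1), dotProduct_mulVec, dotProduct_single, mul_one]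
      rw [h7, h6, Pi.smul_apply, smul_eq_mul, smul_eq_mul, mul_comm]

theorem IsIrreducibleRep.not_common_eigenvector (h : IsIrreducibleRep ρ) {v : Fin 3 → ℂ}
    (hv : v ≠ 0) : ¬ ∀ γ, ∃ c : ℂ, repMatrix ρ γ *ᵥ v = c • v := by
  intro hc
  have hinv : ∀ γ : Γ, ∀ x ∈ Submodule.span ℂ {v},
      (ρ γ : Matrix (Fin 3) (Fin 3) ℂ) *ᵥ x ∈ Submodule.span ℂ {v} := by
    intro γ x hx
    obtain ⟨a, rfl⟩ := Submodule.mem_span_singleton.1 hx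
    obtain ⟨c, hc⟩ := hc γ
    change repMatrix ρ γ *ᵥ (a • v) ∈ _
    rw [mulVec_smul, hc]
    exact Submodule.smul_mem _ _ (Submodule.smul_mem _ _ (Submodule.mem_span_singleton_self v))
  rcases h.2 _ hinv with h1 | h1
  · exact hv (Submodule.span_singleton_eq_bot.1 h1)
  · have h2 := finrank_span_singleton (K := ℂ) hv
    rw [h1, finrank_top] at h2
    simp at h2

/-- The trace form is nondegenerate on the algebra generated by an irreducible representation. -/
theorem IsIrreducibleRep.eq_zero_of_trace (h : IsIrreducibleRep ρ) {e : Matrix (Fin 3) (Fin 3) ℂ}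
    (he : e ∈ Submodule.span ℂ (Set.range (repMatrix ρ)))
    (htr : ∀ γ, (e * repMatrix ρ γ).trace = 0) : e = 0 := by
  set S := Submodule.span ℂ (Set.range (repMatrix ρ)) with hS
  have hmul : ∀ x ∈ S, ∀ y ∈ S, x * y ∈ S := by
    intro x hx y hy
    have := Submodule.mul_mem_mul hx hy
    rw [hS, Submodule.span_mul_span] at this
    refine Submodule.span_mono ?_ this
    rintro _ ⟨_, ⟨a, rfl⟩, _, ⟨b, rfl⟩, rfl⟩
    exact ⟨a * b, repMatrix_mul ρ a b⟩
  have htrS : ∀ x ∈ S, (e * x).trace = 0 := by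
    intro x hx
    induction hx using Submodule.span_induction with
    | mem x hx => obtain ⟨γ, rfl⟩ := hx; exact htr γ
    | zero => rw [mul_zero, trace_zero]
    | add x y _ _ hx hy => rw [mul_add, trace_add, hx, hy, add_zero]
    | smul a x _ hx => rw [mul_smul_comm, trace_smul, hx, smul_zero]
  by_contra hne
  -- By irreducibility the algebra `S` moves `e *ᵥ v` to every vector, in particular back to `v`:
  -- some `w * e` fixes `v`. The first three powers of `w * e` have trace zero, so its cube vanishes
  -- by Cayley-Hamilton, a contradiction.
  obtain ⟨v, hv⟩ : ∃ v, e *ᵥ v ≠ 0 := by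
    by_contra! hcon
    exact hne (Matrix.ext_of_mulVec_single fun i => by rw [hcon, zero_mulVec])
  have hV := h.2 (S.map ((Matrix.mulVecBilin ℂ ℂ).flip (e *ᵥ v))) ?_
  swap
  · rintro γ _ ⟨x, hx, rfl⟩
    refine ⟨repMatrix ρ γ * x, hmul _ (Submodule.subset_span ⟨γ, rfl⟩) _ hx, ?_⟩
    simp [repMatrix, mulVec_mulVec]
  have hv1 : e *ᵥ v ∈ S.map ((Matrix.mulVecBilin ℂ ℂ).flip (e *ᵥ v)) :=
    ⟨1, Submodule.subset_span ⟨1, repMatrix_one ρ⟩, by simp⟩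
  rcases hV with hV | hV
  · rw [hV] at hv1
    exact hv hv1
  have hmem : v ∈ S.map ((Matrix.mulVecBilin ℂ ℂ).flip (e *ᵥ v)) := hV ▸ Submodule.mem_top
  obtain ⟨w, hw, hwv⟩ := hmem
  replace hwv : (w * e) *ᵥ v = v := by simpa [mulVec_mulVec] using hwv
  have t1 : (w * e).trace = 0 := by rw [trace_mul_comm]; exact htrS w hw
  have t2 : ((w * e) * (w * e)).trace = 0 := by
    rw [mul_assoc, trace_mul_comm, mul_assoc, mul_assoc]
    exact htrS _ (hmul _ hw _ (hmul _ he _ hw))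
  have t3 : ((w * e) * ((w * e) * (w * e))).trace = 0 := by
    rw [mul_assoc, trace_mul_comm, mul_assoc, mul_assoc, mul_assoc, mul_assoc]
    exact htrS _ (hmul _ hw _ (hmul _ he _ (hmul _ hw _ (hmul _ he _ hw))))
  have ta : (w * e).adjugate.trace = 0 := by
    have := Matrix.trace_mul_self_fin_three (w * e)
    rw [t1, t2] at this
    linear_combination this / 2
  have hch := Matrix.cube_eq_of_fin_three (w * e)
  have hdet : (w * e).det = 0 := by
    have := congrArg trace hch
    rw [t3, t1, ta] at this
    simpa using this.symm
  rw [t1, ta, hdet] at hch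
  have h0 : ((w * e) * ((w * e) * (w * e))) *ᵥ v = 0 := by rw [hch]; simp
  generalize w * e = N at h0 hwv
  rw [← mulVec_mulVec, ← mulVec_mulVec, hwv, hwv, hwv] at h0
  rw [h0, mulVec_zero] at hv
  exact hv rfl

theorem exists_eigenvector (M : Matrix (Fin 3) (Fin 3) ℂ) :
    ∃ (c : ℂ) (v : Fin 3 → ℂ), v ≠ 0 ∧ M *ᵥ v = c • v := by
  obtain ⟨c, hc⟩ := Module.End.exists_eigenvalue (Matrix.toLin' M)
  obtain ⟨v, hv⟩ := hc.exists_hasEigenvector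
  exact ⟨c, v, hv.2, by simpa using hv.apply_eq_smul⟩

end Irreducible

/-! ### Common eigenvectors of the two generators -/

section D334

open Matrix TriangleGroup

theorem common_eigenvector_of_generators
    {ρ : TriangleGroup 3 3 4 →* Matrix.SpecialLinearGroup (Fin 3) ℂ} {v : Fin 3 → ℂ} {a b : ℂ}
    (hk : repMatrix ρ (k 3 3 4) *ᵥ v = a • v) (hl : repMatrix ρ (l 3 3 4) *ᵥ v = b • v)
    (γ : TriangleGroup 3 3 4) : ∃ c : ℂ, repMatrix ρ γ *ᵥ v = c • v := by
  induction γ using TriangleGroup.induction with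
  | one => exact ⟨1, by rw [repMatrix_one, one_mulVec, one_smul]⟩
  | k => exact ⟨a, hk⟩
  | l => exact ⟨b, hl⟩
  | k_inv =>
    exact ⟨a * a, by rw [← k_mul_k, repMatrix_mul, ← mulVec_mulVec, hk, mulVec_smul, hk, smul_smul]⟩
  | l_inv =>
    exact ⟨b * b, by rw [← l_mul_l, repMatrix_mul, ← mulVec_mulVec, hl, mulVec_smul, hl, smul_smul]⟩
  | mul x y hx hy =>
    obtain ⟨c, hc⟩ := hx
    obtain ⟨d, hd⟩ := hy
    exact ⟨d * c, by rw [repMatrix_mul, ← mulVec_mulVec, hd, mulVec_smul, hc, smul_smul]⟩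

/-- The parameters of a pair with a common eigenvector. -/
theorem IsTracePair.parameters_of_eigenvector {K k L l : Matrix (Fin 3) (Fin 3) ℂ}
    (h : IsTracePair K k L l) {v : Fin 3 → ℂ} (hv : v ≠ 0) {a b : ℂ} (hK : K *ᵥ v = a • v)
    (hL : L *ᵥ v = b • v) :
    a ^ 3 = 1 ∧ (k * L).trace = 2 * a ∧ (K * l).trace = 2 * a ^ 2 := by
  have hk : k *ᵥ v = (a * a) • v := by
    rw [← h.sq_left, ← mulVec_mulVec, hK, mulVec_smul, hK, smul_smul]
  have hl : l *ᵥ v = (b * b) • v := by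
    rw [← h.sq_right, ← mulVec_mulVec, hL, mulVec_smul, hL, smul_smul]
  have cancel : ∀ {x y : ℂ}, x • v = y • v → x = y := fun hxy => smul_left_injective ℂ hv hxy
  have ha : a ^ 3 = 1 := by
    have := congrArg (· *ᵥ v) h.mul_inv_left
    simp only [← mulVec_mulVec, hk, mulVec_smul, hK, smul_smul, one_mulVec] at this
    linear_combination cancel (this.trans (one_smul ℂ v).symm)
  have hb : b ^ 3 = 1 := by
    have := congrArg (· *ᵥ v) h.mul_inv_right
    simp only [← mulVec_mulVec, hl, mulVec_smul, hL, smul_smul, one_mulVec] at this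
    linear_combination cancel (this.trans (one_smul ℂ v).symm)
  have hab4 : (a * b) ^ 4 = 1 := by
    have hM : (K * L) *ᵥ v = (a * b) • v := by
      rw [← mulVec_mulVec, hL, mulVec_smul, hK, smul_smul, mul_comm]
    have := congrArg (· *ᵥ v) h.pow_four
    simp only [pow_succ, pow_zero, one_mul, ← mulVec_mulVec, hM, mulVec_smul, smul_smul,
      one_mulVec] at this
    linear_combination cancel (this.trans (one_smul ℂ v).symm)
  -- Both the third and the fourth power of `a * b` are `1`.
  have hab : a * b = 1 := by linear_combination hab4 - a * b * (b ^ 3 * ha + hb)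
  obtain ⟨s, hs⟩ : ∃ s, s = (k * L).trace := ⟨_, rfl⟩
  obtain ⟨t, ht⟩ : ∃ t, t = (K * l).trace := ⟨_, rfl⟩
  have r := h.relations (A := ℂ) hs ht
  rw [← hs, ← ht]
  -- Applied to the common eigenvector, these two rules become scalar equations that determine `s`
  -- and `t`.
  have e1 := congrArg (· *ᵥ v) r.KLK
  have e2 := congrArg (· *ᵥ v) r.klk
  simp only [add_mulVec, sub_mulVec, ← mulVec_mulVec, smul_mulVec, one_mulVec, hK, hk, hL, hl,
    mulVec_smul, smul_smul, ← add_smul, ← sub_smul] at e1 e2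
  have e1' := cancel e1
  have e2' := cancel e2
  refine ⟨ha, ?_, ?_⟩
  · linear_combination -e1' + 3 * a * hab
  · linear_combination -e2' + (a ^ 2 * (a * b + 1) + 2 * b + 2 * a ^ 2) * hab - 2 * b * ha

end D334

/-! ### Reducible characters in the two-dimensional component -/

section D334

open Matrix TriangleGroup

/-- At the parameters of a reducible pair, the difference of the projections to the eigenlines of
`K` and `L` belongs to the radical of the trace form. -/
theorem IsTracePair.trace_sub_mul_eq_zero {K k L l : Matrix (Fin 3) (Fin 3) ℂ}
    (h : IsTracePair K k L l) {c : ℂ} (hc : c ^ 3 = 1) (hs : 2 * c = (k * L).trace)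
    (ht : 2 * c ^ 2 = (K * l).trace) {X : Matrix (Fin 3) (Fin 3) ℂ}
    (hX : X ∈ TriangleRelations.wordSpan ℂ K k L l) :
    ((c ^ 2 • K + c • k - c • L - c ^ 2 • l) * X).trace = 0 := by
  have hadd := h.trace_commutator_add
  have heq := h.trace_equation
  obtain ⟨s, hs'⟩ : ∃ s, s = 2 * c := ⟨_, rfl⟩
  obtain ⟨t, ht'⟩ : ∃ t, t = 2 * c ^ 2 := ⟨_, rfl⟩
  obtain ⟨z, hz⟩ : ∃ z, z = (K * (L * (k * l))).trace := ⟨_, rfl⟩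
  obtain ⟨z', hz'⟩ : ∃ z', z' = (L * (K * (l * k))).trace := ⟨_, rfl⟩
  rw [← hz, ← hs, ← ht] at heq
  rw [← hz, ← hz', ← hs, ← ht] at hadd
  -- At these values of `s` and `t` the quadratic equation for `z` has the double root `1`.
  have hz1 : z = 1 := by
    have : (z - 1) ^ 2 = 0 := by grind
    exact sub_eq_zero.1 (pow_eq_zero_iff two_ne_zero |>.1 this)
  have hz1' : z' = 1 := by grind
  rw [← hs'] at hs
  rw [← ht'] at ht
  have hs2 : s = (L * k).trace := hs.trans (Matrix.trace_mul_comm _ _)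
  have ht2 : t = (l * K).trace := ht.trans (Matrix.trace_mul_comm _ _)
  have r := h.relations (A := ℂ) hs ht
  have r' := h.symm.relations (A := ℂ) ht2 hs2
  induction hX using Submodule.span_induction with
  | zero => rw [mul_zero, trace_zero]
  | add x y _ _ hx hy => rw [mul_add, trace_add, hx, hy, add_zero]
  | smul a x _ hx => rw [mul_smul_comm, trace_smul, hx, smul_zero]
  | mem x hx =>
    simp only [Set.mem_insert_iff, Set.mem_singleton_iff] at hx
    rcases hx with hx | hx | hx | hx | hx | hx | hx | hx | hx | hx | hx | hx | hx |
      hx | hx | hx | hx | hx | hx <;> rw [hx] <;>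
    simp only [mul_one, mul_add, mul_sub, add_mul, sub_mul, mul_smul_comm, smul_mul_assoc, smul_add,
    smul_sub, mul_assoc, r.sq, r.sq_mul, r.mul_inv, r.mul_inv_mul, r.inv_mul, r.inv_mul_mul,
    r.inv_sq, r.inv_sq_mul, r.KLK, r.KLK_mul, r.KlK, r.kLk, r.kLk_mul, r.klk,
    r.kLK, r.kLK_mul, r.klK, r'.sq, r'.sq_mul, r'.mul_inv,
    r'.mul_inv_mul, r'.inv_mul, r'.inv_mul_mul, r'.inv_sq, r'.inv_sq_mul, r'.KLK, r'.KLK_mul,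
    r'.KlK, r'.kLk, r'.kLk_mul, r'.klk, r'.kLK, r'.kLK_mul, r'.klK,
    Matrix.trace_add, Matrix.trace_sub, Matrix.trace_smul, Matrix.trace_one,
    smul_eq_mul, Fintype.card_fin] <;>
    simp only [h.trace_left, h.trace_left_inv, h.trace_right, h.trace_right_inv, h.trace_mul,
      h.trace_inv_mul, h.symm.trace_mul, h.symm.trace_inv_mul, h.trace_conj, h.symm.trace_conj,
      ← hs, ← ht, ← hs2, ← ht2, ← hz, ← hz', hz1, hz1'] <;>
    push_cast <;> grind

variable {ρ : TriangleGroup 3 3 4 →* Matrix.SpecialLinearGroup (Fin 3) ℂ}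

/-- If `ρ` were irreducible, the trace form would be nondegenerate on the span of its image, so the
radical element of `trace_sub_mul_eq_zero` would vanish and yield a common eigenvector. -/
theorem not_isIrreducibleRep_of_parameters (h : HasGenericValues (slCharacter ρ)) {c : ℂ}
    (hc : c ^ 3 = 1) (hp : parametersD334 (slCharacter ρ) = ![2 * c, 2 * c ^ 2, 1]) :
    ¬ IsIrreducibleRep ρ := by
  intro hirr
  rw [parametersD334_slCharacter] at hp
  have hP := isTracePair_of_hasGenericValues h
  have hs : 2 * c = (repMatrix ρ (k 3 3 4)⁻¹ * repMatrix ρ (l 3 3 4)).trace := (congrFun hp 0).symm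
  have ht : 2 * c ^ 2 = (repMatrix ρ (k 3 3 4) * repMatrix ρ (l 3 3 4)⁻¹).trace :=
    (congrFun hp 1).symm
  have r := hP.relations (A := ℂ) hs ht
  have r' := hP.symm.relations (A := ℂ) (ht.trans (trace_mul_comm _ _))
    (hs.trans (trace_mul_comm _ _))
  have hspan : ∀ γ, repMatrix ρ γ ∈ Submodule.span ℂ (Set.range (repMatrix ρ)) :=
    fun γ => Submodule.subset_span ⟨γ, rfl⟩
  have he := hirr.eq_zero_of_trace
    (e := c ^ 2 • repMatrix ρ (k 3 3 4) + c • repMatrix ρ (k 3 3 4)⁻¹ - c • repMatrix ρ (l 3 3 4)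
      - c ^ 2 • repMatrix ρ (l 3 3 4)⁻¹)
    (sub_mem (sub_mem (add_mem (Submodule.smul_mem _ _ (hspan _)) (Submodule.smul_mem _ _ (hspan _)))
      (Submodule.smul_mem _ _ (hspan _))) (Submodule.smul_mem _ _ (hspan _)))
    (fun γ => hP.trace_sub_mul_eq_zero hc hs ht
      (r.map_mem_wordSpan r' (repMatrix_one ρ) (repMatrix_mul ρ) γ))
  set K := repMatrix ρ (k 3 3 4)
  set k := repMatrix ρ (TriangleGroup.k 3 3 4)⁻¹
  set L := repMatrix ρ (l 3 3 4)
  set l := repMatrix ρ (TriangleGroup.l 3 3 4)⁻¹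
  have he' : c ^ 2 • K + c • k = c • L + c ^ 2 • l := by
    rw [sub_sub, sub_eq_zero] at he
    exact he
  -- Three times the projection to the `c`-eigenline of `K`. By `he'` it is also three times the
  -- projection to the `c ^ 2`-eigenline of `L`, so its nonzero columns are common eigenvectors; its
  -- trace is `3`.
  obtain ⟨E, hE⟩ : ∃ E, E = 1 + (c ^ 2 • K + c • k) := ⟨_, rfl⟩
  have hKE : K * E = c • E := by
    rw [hE, mul_add, mul_add, mul_smul_comm, mul_smul_comm, hP.sq_left, hP.mul_inv_left]
    simp only [smul_add, smul_smul, mul_one, ← pow_succ', ← pow_two, hc, one_smul]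
    abel
  have hLE : L * E = c ^ 2 • E := by
    rw [hE, he', mul_add, mul_add, mul_smul_comm, mul_smul_comm, hP.sq_right, hP.mul_inv_right]
    have hc4 : c ^ 2 * c ^ 2 = c := by linear_combination c * hc
    simp only [smul_add, smul_smul, mul_one, ← pow_succ, hc4, hc, one_smul]
    abel
  have hE0 : E ≠ 0 := by
    intro h0
    have := congrArg trace hE
    rw [h0] at this
    simp [hP.trace_left, hP.trace_left_inv] at this
  obtain ⟨v, hv⟩ : ∃ v, E *ᵥ v ≠ 0 := by
    by_contra! hcon
    exact hE0 (Matrix.ext_of_mulVec_single fun i => by rw [hcon, zero_mulVec])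
  refine hirr.not_common_eigenvector hv (common_eigenvector_of_generators (a := c) (b := c ^ 2) ?_ ?_)
  · rw [mulVec_mulVec, hKE, smul_mulVec]
  · rw [mulVec_mulVec, hLE, smul_mulVec]

theorem exists_parameters_of_not_isIrreducibleRep (h : HasGenericValues (slCharacter ρ))
    (hirr : ¬ IsIrreducibleRep ρ) :
    ∃ c : ℂ, c ^ 3 = 1 ∧ parametersD334 (slCharacter ρ) = ![2 * c, 2 * c ^ 2, 1] := by
  have hP := isTracePair_of_hasGenericValues h
  have key : ∃ c : ℂ, c ^ 3 = 1 ∧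
      (repMatrix ρ (k 3 3 4)⁻¹ * repMatrix ρ (l 3 3 4)).trace = 2 * c ∧
      (repMatrix ρ (k 3 3 4) * repMatrix ρ (l 3 3 4)⁻¹).trace = 2 * c ^ 2 := by
    rcases exists_common_eigenvector hirr with ⟨v, hv, hγ⟩ | ⟨v, hv, hγ⟩
    · obtain ⟨a, ha⟩ := hγ (k 3 3 4)
      obtain ⟨b, hb⟩ := hγ (l 3 3 4)
      exact ⟨a, hP.parameters_of_eigenvector hv ha hb⟩
    · obtain ⟨a, ha⟩ := hγ (k 3 3 4)
      obtain ⟨b, hb⟩ := hγ (l 3 3 4)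
      have := hP.transpose.parameters_of_eigenvector hv ha hb
      rw [← transpose_mul, ← transpose_mul, trace_transpose, trace_transpose, trace_mul_comm,
        trace_mul_comm (repMatrix ρ (l 3 3 4)⁻¹)] at this
      exact ⟨a, this⟩
  obtain ⟨c, hc, hs, ht⟩ := key
  refine ⟨c, hc, ?_⟩
  have heq := hP.trace_equation
  rw [hs, ht] at heq
  rw [parametersD334_slCharacter, hs, ht]
  congr 3
  have : ((repMatrix ρ (k 3 3 4) * (repMatrix ρ (l 3 3 4) *
      (repMatrix ρ (k 3 3 4)⁻¹ * repMatrix ρ (l 3 3 4)⁻¹))).trace - 1) ^ 2 = 0 := by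
    linear_combination heq + (-8 * c ^ 3 + 4 *
      (repMatrix ρ (k 3 3 4) * (repMatrix ρ (l 3 3 4) *
      (repMatrix ρ (k 3 3 4)⁻¹ * repMatrix ρ (l 3 3 4)⁻¹))).trace + 4) * hc
  exact sub_eq_zero.1 (pow_eq_zero_iff two_ne_zero |>.1 this)

theorem notMem_irreducibleCharacters_iff {χ : ZariskiSpace (TriangleGroup 3 3 4)}
    (h : χ ∈ componentD334) :
    χ ∉ irreducibleCharacters (TriangleGroup 3 3 4) 3 ↔
      ∃ c : ℂ, c ^ 3 = 1 ∧ parametersD334 χ = ![2 * c, 2 * c ^ 2, 1] := by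
  constructor
  · intro hn
    obtain ⟨⟨ρ, rfl⟩, h⟩ := h
    exact exists_parameters_of_not_isIrreducibleRep h fun hirr => hn ⟨ρ, hirr, rfl⟩
  · rintro ⟨c, hc, hp⟩ ⟨ρ, hirr, rfl⟩
    exact not_isIrreducibleRep_of_parameters h.2 hc hp hirr

end D334

/-! ### The exceptional irreducible characters -/

section Exceptional

open Matrix TriangleGroup

/-- The eigenvalues of multiplicity two of the image of `k * l` in the exceptional
representations. -/
noncomputable def exceptionalEigenvalue : Fin 3 → ℂ := ![-1, Complex.I, -Complex.I]

theorem exceptionalEigenvalue_pow_four (i : Fin 3) : exceptionalEigenvalue i ^ 4 = 1 := by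
  fin_cases i <;> simp [exceptionalEigenvalue, Even.neg_pow (by decide : Even 4)]

theorem exceptionalEigenvalue_ne_one (i : Fin 3) : exceptionalEigenvalue i ≠ 1 := by
  fin_cases i <;> simp [exceptionalEigenvalue, Complex.ext_iff]; norm_num

theorem exists_exceptionalEigenvalue {a : ℂ} (h4 : a ^ 4 = 1) (h1 : a ≠ 1) :
    ∃ i, exceptionalEigenvalue i = a := by
  have : (a - 1) * ((a + 1) * ((a - Complex.I) * (a + Complex.I))) = 0 := by
    linear_combination h4 - (a ^ 2 - 1) * Complex.I_sq
  rcases mul_eq_zero.1 this with h | h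
  · exact absurd (sub_eq_zero.1 h) h1
  rcases mul_eq_zero.1 h with h | h
  · exact ⟨0, (eq_neg_of_add_eq_zero_left h).symm⟩
  rcases mul_eq_zero.1 h with h | h
  · exact ⟨1, (sub_eq_zero.1 h).symm⟩
  · exact ⟨2, (eq_neg_of_add_eq_zero_left h).symm⟩

/-- The cyclic permutation matrix. -/
def cyclicMatrix : Matrix (Fin 3) (Fin 3) ℂ := !![0, 0, 1; 1, 0, 0; 0, 1, 0]

/-- The image of `l` in an exceptional representation. -/
def exceptionalMatrix (a : ℂ) : Matrix (Fin 3) (Fin 3) ℂ := !![0, a, 0; 0, 0, a; a ^ 2, 0, 0]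

theorem cyclicMatrix_mul_exceptionalMatrix (a : ℂ) :
    cyclicMatrix * exceptionalMatrix a = diagonal ![a ^ 2, a, a] := by
  ext i j
  fin_cases i <;> fin_cases j <;> simp [cyclicMatrix, exceptionalMatrix]

theorem exists_exceptional_representation {a : ℂ} (h4 : a ^ 4 = 1) :
    ∃ ρ : TriangleGroup 3 3 4 →* Matrix.SpecialLinearGroup (Fin 3) ℂ,
      repMatrix ρ (k 3 3 4) = cyclicMatrix ∧ repMatrix ρ (l 3 3 4) = exceptionalMatrix a := by
  apply TriangleGroup.exists_representation
  · simp [cyclicMatrix, det_fin_three]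
  · simp [exceptionalMatrix, det_fin_three]
    linear_combination h4
  · rw [pow_succ, pow_two]
    ext i j
    fin_cases i <;> fin_cases j <;> simp [cyclicMatrix]
  · rw [pow_succ, pow_two]
    ext i j
    fin_cases i <;> fin_cases j <;> simp [exceptionalMatrix] <;> linear_combination h4
  · rw [cyclicMatrix_mul_exceptionalMatrix, diagonal_pow, ← diagonal_one]
    congr 1
    ext i
    fin_cases i <;> simp [h4]
    linear_combination (a ^ 4 + 1) * h4

variable {ρ : TriangleGroup 3 3 4 →* Matrix.SpecialLinearGroup (Fin 3) ℂ}

theorem slCharacter_mul_of_exceptional {a : ℂ} (hK : repMatrix ρ (k 3 3 4) = cyclicMatrix)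
    (hL : repMatrix ρ (l 3 3 4) = exceptionalMatrix a) :
    slCharacter ρ (k 3 3 4 * l 3 3 4) = a ^ 2 + 2 * a := by
  rw [slCharacter_apply, repMatrix_mul, hK, hL, cyclicMatrix_mul_exceptionalMatrix, trace_diagonal,
    Fin.sum_univ_three]
  simp
  ring

theorem exceptional_trace_ne_one (i : Fin 3) :
    exceptionalEigenvalue i ^ 2 + 2 * exceptionalEigenvalue i ≠ 1 := by
  fin_cases i <;> simp [exceptionalEigenvalue, Complex.ext_iff]

theorem exceptional_trace_injective : Function.Injective
    fun i => exceptionalEigenvalue i ^ 2 + 2 * exceptionalEigenvalue i := by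
  intro i j h
  fin_cases i <;> fin_cases j <;> simp [exceptionalEigenvalue, Complex.ext_iff] at h ⊢ <;>
    norm_num at h

/-- Since `a ^ 2 ≠ a`, the projection to the first coordinate is a polynomial in the image of `k *
l`. An invariant subspace is stable under it and under the cyclic shift, so a nonzero one contains
every basis vector. -/
theorem isIrreducibleRep_of_exceptional {a : ℂ} (h4 : a ^ 4 = 1) (h1 : a ≠ 1)
    (hK : repMatrix ρ (k 3 3 4) = cyclicMatrix)
    (hL : repMatrix ρ (l 3 3 4) = exceptionalMatrix a) : IsIrreducibleRep ρ := by
  refine ⟨by norm_num, fun V hV => ?_⟩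
  rw [or_iff_not_imp_left]
  intro hbot
  have ha0 : a ≠ 0 := by rintro rfl; norm_num at h4
  have haa : a ^ 2 - a ≠ 0 := by
    rw [pow_two, ← mul_sub_one]
    exact mul_ne_zero ha0 (sub_ne_zero.2 h1)
  have hcyc : ∀ x ∈ V, ![x 2, x 0, x 1] ∈ V := by
    intro x hx
    have := hV (k 3 3 4) x hx
    change repMatrix ρ _ *ᵥ x ∈ V at this
    rw [hK] at this
    convert this using 1
    ext i
    fin_cases i <;> simp [cyclicMatrix, mulVec, dotProduct, Fin.sum_univ_three]
  have hdiag : ∀ x ∈ V, ![x 0, 0, 0] ∈ V := by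
    intro x hx
    have := hV (k 3 3 4 * l 3 3 4) x hx
    change repMatrix ρ _ *ᵥ x ∈ V at this
    rw [repMatrix_mul, hK, hL, cyclicMatrix_mul_exceptionalMatrix] at this
    have := Submodule.smul_mem V (a ^ 2 - a)⁻¹ (Submodule.sub_mem V this (Submodule.smul_mem V a hx))
    convert this using 1
    ext i
    fin_cases i <;> simp [mulVec_diagonal]
    rw [← sub_mul, inv_mul_cancel_left₀ haa]
  have h0 : ∀ x ∈ V, x 0 ≠ 0 → V = ⊤ := by
    intro x hx hx0
    have e0 : ![1, 0, 0] ∈ V := by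
      have := Submodule.smul_mem V (x 0)⁻¹ (hdiag x hx)
      simpa [hx0] using this
    have e1 : ![0, 1, 0] ∈ V := by simpa using hcyc _ e0
    have e2 : ![0, 0, 1] ∈ V := by simpa using hcyc _ e1
    rw [eq_top_iff]
    intro y _
    have := add_mem (add_mem (Submodule.smul_mem V (y 0) e0) (Submodule.smul_mem V (y 1) e1))
      (Submodule.smul_mem V (y 2) e2)
    convert this using 1
    ext i
    fin_cases i <;> simp
  obtain ⟨x, hx, hx0⟩ := V.ne_bot_iff.1 hbot
  by_cases hx0' : x 0 = 0
  · by_cases hx2 : x 2 = 0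
    · by_cases hx1 : x 1 = 0
      · refine absurd ?_ hx0
        ext i
        fin_cases i <;> simpa
      · exact h0 _ (hcyc _ (hcyc x hx)) hx1
    · exact h0 _ (hcyc x hx) hx2
  · exact h0 x hx hx0'

/-- Intertwined representations have the same character. -/
theorem slCharacter_eq_of_intertwining {ρ' : TriangleGroup 3 3 4 →* Matrix.SpecialLinearGroup (Fin 3) ℂ}
    {Q : Matrix (Fin 3) (Fin 3) ℂ} (hQ : Q.det ≠ 0)
    (hK : repMatrix ρ (k 3 3 4) * Q = Q * repMatrix ρ' (k 3 3 4))
    (hL : repMatrix ρ (l 3 3 4) * Q = Q * repMatrix ρ' (l 3 3 4)) :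
    slCharacter ρ = slCharacter ρ' := by
  have key : ∀ γ, repMatrix ρ γ * Q = Q * repMatrix ρ' γ := by
    intro γ
    have hmul : ∀ x y, repMatrix ρ x * Q = Q * repMatrix ρ' x →
        repMatrix ρ y * Q = Q * repMatrix ρ' y →
        repMatrix ρ (x * y) * Q = Q * repMatrix ρ' (x * y) := by
      intro x y hx hy
      rw [repMatrix_mul, repMatrix_mul, mul_assoc, hy, ← mul_assoc, hx, mul_assoc]
    induction γ using TriangleGroup.induction with
    | one => rw [repMatrix_one, repMatrix_one, one_mul, mul_one]
    | k => exact hK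
    | l => exact hL
    | k_inv => rw [← k_mul_k]; exact hmul _ _ hK hK
    | l_inv => rw [← l_mul_l]; exact hmul _ _ hL hL
    | mul x y hx hy => exact hmul _ _ hx hy
  have hu : IsUnit Q.det := isUnit_iff_ne_zero.2 hQ
  funext γ
  rw [slCharacter_apply, slCharacter_apply]
  have : repMatrix ρ γ = Q * repMatrix ρ' γ * Q⁻¹ := by
    rw [← key, mul_assoc, mul_nonsing_inv _ hu, mul_one]
  rw [this, trace_mul_comm, ← mul_assoc, nonsing_inv_mul _ hu, one_mul]

/-- Serves to show that `k`, `l` and `k * l` are not scalar: if one of them were, the eigenvectors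
of a suitable generator `y` would be eigenvectors of both generators. -/
theorem IsIrreducibleRep.not_forall_eigenvector (h : IsIrreducibleRep ρ)
    (y : TriangleGroup 3 3 4) : ¬ ∀ (v : Fin 3 → ℂ) (d : ℂ), repMatrix ρ y *ᵥ v = d • v →
      (∃ a : ℂ, repMatrix ρ (k 3 3 4) *ᵥ v = a • v) ∧
      ∃ b : ℂ, repMatrix ρ (l 3 3 4) *ᵥ v = b • v := by
  intro hy
  obtain ⟨d, v, hv, hd⟩ := exists_eigenvector (repMatrix ρ y)
  obtain ⟨⟨a, ha⟩, b, hb⟩ := hy v d hd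
  exact h.not_common_eigenvector hv (common_eigenvector_of_generators ha hb)

theorem IsIrreducibleRep.k_ne_smul_one (h : IsIrreducibleRep ρ) (c : ℂ) :
    repMatrix ρ (k 3 3 4) ≠ c • 1 := by
  intro hc
  refine h.not_forall_eigenvector (l 3 3 4) fun v d hd => ⟨⟨c, ?_⟩, d, hd⟩
  rw [hc, smul_mulVec, one_mulVec]

theorem IsIrreducibleRep.l_ne_smul_one (h : IsIrreducibleRep ρ) (c : ℂ) :
    repMatrix ρ (l 3 3 4) ≠ c • 1 := by
  intro hc
  refine h.not_forall_eigenvector (k 3 3 4) fun v d hd => ⟨⟨d, hd⟩, c, ?_⟩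
  rw [hc, smul_mulVec, one_mulVec]

theorem IsIrreducibleRep.k_mul_l_ne_smul_one (h : IsIrreducibleRep ρ) (c : ℂ) :
    repMatrix ρ (k 3 3 4 * l 3 3 4) ≠ c • 1 := by
  intro hc
  refine h.not_forall_eigenvector (k 3 3 4) fun v d hd => ⟨⟨d, hd⟩, c * (d * d), ?_⟩
  have hl : l 3 3 4 = k 3 3 4 * k 3 3 4 * (k 3 3 4 * l 3 3 4) := by
    rw [k_mul_k, inv_mul_cancel_left]
  rw [hl, repMatrix_mul, hc, repMatrix_mul, mul_smul_comm, mul_one, smul_mulVec, ← mulVec_mulVec,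
    hd, mulVec_smul, hd, smul_smul, smul_smul, mul_assoc]

end Exceptional

/-! ### Matrices of order three and four -/

section Order

open Matrix

/-- With `X ^ 3 = 1`, Cayley-Hamilton becomes a proportionality between `X ^ 2` and `X`, hence
between `X` and `1`; as `X` is not scalar, both coefficients vanish. -/
theorem trace_eq_zero_of_order_three {X : Matrix (Fin 3) (Fin 3) ℂ} (hdet : X.det = 1)
    (h : X * (X * X) = 1) (hX : ∀ c : ℂ, X ≠ c • 1) : X.trace = 0 ∧ (X * X).trace = 0 := by
  have hch := Matrix.cube_eq_of_fin_three X
  rw [h, hdet, one_smul, Matrix.adjugate_eq_of_mul_eq_one hdet h, eq_comm, add_eq_right,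
    sub_eq_zero] at hch
  have h' : X * X * X = 1 := by rw [mul_assoc, h]
  have h2 : X.trace • X = (X * X).trace • 1 := by
    have := congrArg (X * X * ·) hch
    simpa only [mul_smul_comm, h', mul_assoc, h, mul_one] using this
  have ht : X.trace = 0 := by
    by_contra hne
    apply hX (X.trace⁻¹ * (X * X).trace)
    rw [mul_smul, ← h2, smul_smul, inv_mul_cancel₀ hne, one_smul]
  refine ⟨ht, ?_⟩
  rw [ht, zero_smul, eq_comm, smul_eq_zero] at h2
  exact h2.resolve_right one_ne_zero

theorem exists_trace_eq_natCast_of_idempotent {P : Matrix (Fin 3) (Fin 3) ℂ} (hP : P * P = P) :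
    ∃ n : ℕ, n ≤ 3 ∧ P.trace = (n : ℂ) ∧ (n = 0 → P = 0) ∧
      (n = 1 → ∃ u φ : Fin 3 → ℂ, P = vecMulVec u φ) := by
  have hid : IsIdempotentElem (toLin' P) := by
    rw [IsIdempotentElem, Module.End.mul_eq_comp, ← toLin'_mul, hP]
  have htr : P.trace = (Module.finrank ℂ (LinearMap.range (toLin' P)) : ℂ) := by
    rw [← (LinearMap.IsIdempotentElem.isProj_range _ hid).trace, trace_toLin'_eq]
  refine ⟨_, ?_, htr, ?_, ?_⟩
  · simpa using Submodule.finrank_le (LinearMap.range (toLin' P))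
  · intro h0
    rw [Submodule.finrank_eq_zero, LinearMap.range_eq_bot] at h0
    simpa using h0
  · intro h1
    obtain ⟨⟨u, hu⟩, -, hspan⟩ := finrank_eq_one_iff'.1 h1
    choose φ hφ using fun j => hspan ⟨toLin' P (Pi.single j 1), LinearMap.mem_range_self _ _⟩
    refine ⟨u, φ, ?_⟩
    ext i j
    have := congrFun (congrArg Subtype.val (hφ j)) i
    simp only [SetLike.mk_smul_mk, toLin'_apply, mulVec_single_one, Pi.smul_apply,
      smul_eq_mul, col_apply] at this
    rw [vecMulVec_apply, ← this, mul_comm]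

/-- A matrix of order four in `SL(3)` that is not scalar has either three different eigenvalues or
two. -/
theorem trace_eq_one_or_exists_idempotent {M : Matrix (Fin 3) (Fin 3) ℂ} (hdet : M.det = 1)
    (h4 : M ^ 4 = 1) (hM : ∀ c : ℂ, M ≠ c • 1) :
    (M.trace = 1 ∧ M.adjugate.trace = 1) ∨
    ∃ (a b : ℂ) (u φ : Fin 3 → ℂ), a ≠ b ∧ (vecMulVec u φ).trace = 1 ∧
      M = a • 1 + (b - a) • vecMulVec u φ := by
  obtain ⟨t, ht⟩ : ∃ t, t = M.trace := ⟨_, rfl⟩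
  obtain ⟨s, hs⟩ : ∃ s, s = M.adjugate.trace := ⟨_, rfl⟩
  have h3 := Matrix.cube_eq_of_fin_three M
  rw [hdet, ← ht, ← hs] at h3
  -- The remainder of `M ^ 4 = 1` modulo Cayley-Hamilton. If all its coefficients vanish, then `t =
  -- s = 1`; if only the quadratic one is missing, `M` would be scalar; otherwise `M` has a
  -- quadratic annihilating polynomial.
  have hq : (t ^ 2 - s) • (M * M) + (1 - t * s) • M + (t - 1) • (1 : Matrix (Fin 3) (Fin 3) ℂ)
      = 0 := by
    have e : M ^ 4 = M * (M * (M * M)) := by noncomm_ring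
    rw [h4, h3, mul_add, mul_sub, mul_smul_comm, h3, mul_smul_comm, mul_smul_comm, mul_one] at e
    rw [← sub_eq_zero] at e
    rw [← neg_eq_zero, ← e]
    module
  rw [← ht, ← hs]
  by_cases hα : t ^ 2 - s = 0
  · by_cases hβ : 1 - t * s = 0
    · left
      rw [hα, hβ, zero_smul, zero_smul, zero_add, zero_add, smul_eq_zero] at hq
      have h1 : t = 1 := sub_eq_zero.1 (hq.resolve_right one_ne_zero)
      rw [h1] at hα
      exact ⟨h1, by linear_combination -hα⟩
    · exfalso
      rw [hα, zero_smul, zero_add] at hq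
      apply hM ((1 - t * s)⁻¹ * (1 - t))
      rw [mul_smul, eq_inv_smul_iff₀ hβ, ← sub_eq_zero, ← hq]
      module
  right
  obtain ⟨d, hd⟩ := IsAlgClosed.exists_pow_nat_eq
    ((1 - t * s) ^ 2 - 4 * (t ^ 2 - s) * (t - 1)) (n := 2) (by norm_num)
  obtain ⟨a, ha⟩ : ∃ a, a = (-(1 - t * s) - d) / (2 * (t ^ 2 - s)) := ⟨_, rfl⟩
  obtain ⟨b, hb⟩ : ∃ b, b = (-(1 - t * s) + d) / (2 * (t ^ 2 - s)) := ⟨_, rfl⟩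
  have hMM : M * M = (a + b) • M - (a * b) • 1 := by
    have e1 : (t ^ 2 - s) * (a + b) = -(1 - t * s) := by
      rw [ha, hb]; field_simp; ring
    have e2 : (t ^ 2 - s) * (a * b) = t - 1 := by
      rw [ha, hb]; field_simp; linear_combination -hd
    have : (t ^ 2 - s) • (M * M - ((a + b) • M - (a * b) • 1)) = 0 := by
      rw [smul_sub, smul_sub, smul_smul, smul_smul, e1, e2, ← hq]
      module
    exact sub_eq_zero.1 ((smul_eq_zero.1 this).resolve_left hα)
  by_cases hab : a = b
  · exfalso
    have e : M ^ 4 = (M * M) * (M * M) := by noncomm_ring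
    -- For a double root, `x ^ 4` is congruent to its tangent `4 * a ^ 3 * x - 3 * a ^ 4` modulo `(x
    -- - a) ^ 2`, so `M` would be scalar.
    have e' : (4 * a ^ 3) • M = (1 + 3 * a ^ 4) • 1 := by
      rw [h4, hMM, ← hab] at e
      simp only [mul_sub, sub_mul, smul_mul_assoc, mul_smul_comm, mul_one, one_mul, hMM, ← hab] at e
      calc (4 * a ^ 3) • M = (a + a) • ((a + a) • ((a + a) • M - (a * a) • 1) - (a * a) • M) -
            (a * a) • ((a + a) • M - (a * a) • 1) + (3 * a ^ 4) • 1 := by module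
        _ = _ := by rw [← e, add_smul, one_smul]
    by_cases ha0 : a = 0
    · rw [ha0] at e'
      simp at e'
    · have h4a : 4 * a ^ 3 ≠ 0 := by simp [ha0]
      apply hM ((4 * a ^ 3)⁻¹ * (1 + 3 * a ^ 4))
      rw [mul_smul, eq_inv_smul_iff₀ h4a, e']
  · have hba : b - a ≠ 0 := sub_ne_zero.2 (Ne.symm hab)
    obtain ⟨P, hPe⟩ : ∃ P, P = (b - a)⁻¹ • (M - a • 1) := ⟨_, rfl⟩
    have hMP : M = a • 1 + (b - a) • P := by
      rw [hPe, smul_inv_smul₀ hba]; abel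
    have hP : P * P = P := by
      have : (b - a) • (b - a) • (P * P - P) = 0 := by
        have e : (b - a) • P = M - a • 1 := by rw [hPe, smul_inv_smul₀ hba]
        have : (b - a) • (b - a) • (P * P - P) = ((b - a) • P) * ((b - a) • P) -
          (b - a) • ((b - a) • P) := by
          simp only [smul_mul_assoc, mul_smul_comm, smul_sub]
        rw [this, e]
        simp only [mul_sub, sub_mul, smul_mul_assoc, mul_smul_comm, mul_one, one_mul, hMM]
        module
      exact sub_eq_zero.1 (((smul_eq_zero.1 ((smul_eq_zero.1 this).resolve_left hba))).resolve_left
        hba)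
    have hP' : (1 - P) * (1 - P) = 1 - P := by
      simp only [mul_sub, sub_mul, mul_one, one_mul, hP]; abel
    obtain ⟨n, hn3, hn, hn0, hn1⟩ := exists_trace_eq_natCast_of_idempotent hP
    obtain ⟨m, hm3, hm, hm0, hm1⟩ := exists_trace_eq_natCast_of_idempotent hP'
    have hnm : m + n = 3 := by
      have : ((m + n : ℕ) : ℂ) = (3 : ℕ) := by
        push_cast
        rw [← hn, ← hm, trace_sub, trace_one]
        simp
      exact_mod_cast this
    -- Ranks `0` and `3` make `M` scalar. In rank `2` the complementary projection has rank one and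
    -- `a`, `b` exchange roles.
    obtain rfl | rfl | rfl | rfl : n = 0 ∨ n = 1 ∨ n = 2 ∨ n = 3 := by omega
    · exact absurd (by rw [hMP, hn0 rfl, smul_zero, add_zero]) (hM a)
    · obtain ⟨u, φ, hu⟩ := hn1 rfl
      exact ⟨a, b, u, φ, hab, by rw [← hu, hn]; simp, by rw [← hu]; exact hMP⟩
    · obtain ⟨u, φ, hu⟩ := hm1 (by omega)
      refine ⟨b, a, u, φ, Ne.symm hab, ?_, ?_⟩
      · rw [← hu, hm, show m = 1 by omega]; simp
      · rw [← hu, hMP]; module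
    · refine absurd ?_ (hM b)
      have hP1 : P = 1 := (sub_eq_zero.1 (hm0 (by omega))).symm
      rw [hMP, hP1]; module

end Order

/-! ### Classification of the irreducible characters -/

section Classification

open Matrix TriangleGroup

/-- If `K` has order three, a projection of rank one that is orthogonal to `K` and `K ^ 2` for the
trace form is conjugate to a matrix unit in a basis that is permuted by `K`. -/
theorem exists_cyclic_basis {K : Matrix (Fin 3) (Fin 3) ℂ} (h3 : K * (K * K) = 1)
    {u φ : Fin 3 → ℂ} (h0 : (vecMulVec u φ).trace = 1) (h1 : (vecMulVec u φ * K).trace = 0)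
    (h2 : (vecMulVec u φ * (K * K)).trace = 0) :
    ∃ Q : Matrix (Fin 3) (Fin 3) ℂ, Q.det ≠ 0 ∧ K * Q = Q * cyclicMatrix ∧
      vecMulVec u φ * Q = Q * diagonal ![1, 0, 0] := by
  rw [trace_vecMulVec] at h0
  rw [vecMulVec_mul, trace_vecMulVec] at h1 h2
  have e0 : vecMulVec u φ *ᵥ u = u := by
    rw [vecMulVec_mulVec, dotProduct_comm, h0]; simp
  have e1 : vecMulVec u φ *ᵥ (K *ᵥ u) = 0 := by
    rw [vecMulVec_mulVec, dotProduct_mulVec, dotProduct_comm, h1]; simp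
  have e2 : vecMulVec u φ *ᵥ (K *ᵥ (K *ᵥ u)) = 0 := by
    rw [mulVec_mulVec u, vecMulVec_mulVec, dotProduct_mulVec, dotProduct_comm, h2]; simp
  have e3 : K *ᵥ (K *ᵥ (K *ᵥ u)) = u := by
    rw [mulVec_mulVec u, mulVec_mulVec, h3, one_mulVec]
  have hu : u ≠ 0 := by
    rintro rfl
    rw [zero_dotProduct] at h0
    exact zero_ne_one h0
  obtain ⟨v, hv⟩ : ∃ v, v = K *ᵥ u := ⟨_, rfl⟩
  obtain ⟨w, hw⟩ : ∃ w, w = K *ᵥ v := ⟨_, rfl⟩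
  rw [← hv] at e1 e2 e3
  rw [← hw] at e2 e3
  have hcol : ∀ (M : Matrix (Fin 3) (Fin 3) ℂ) (j : Fin 3),
      M *ᵥ (fun i => ![u, v, w] j i) = ![M *ᵥ u, M *ᵥ v, M *ᵥ w] j := by
    intro M j
    fin_cases j <;> rfl
  refine ⟨of fun i j => ![u, v, w] j i, ?_, ?_, ?_⟩
  · intro hdet
    obtain ⟨x, hx0, hx⟩ := exists_mulVec_eq_zero_iff.2 hdet
    have hx' : x 0 • u + x 1 • v + x 2 • w = 0 := by
      rw [← hx]
      ext i
      simp [mulVec, dotProduct, Fin.sum_univ_three, mul_comm]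
    -- The projection keeps `u` and kills `K u` and `K ^ 2 u`. Applying it after the powers of `K`
    -- isolates each coefficient of a linear relation.
    have x0 : x 0 = 0 := by
      have := congrArg (vecMulVec u φ *ᵥ ·) hx'
      simp only [mulVec_add, mulVec_smul, e0, e1, e2, smul_zero, add_zero, mulVec_zero] at this
      exact (smul_eq_zero.1 this).resolve_right hu
    have x2 : x 2 = 0 := by
      have := congrArg (fun y => vecMulVec u φ *ᵥ (K *ᵥ y)) hx'
      simp only [mulVec_add, mulVec_smul, e0, e1, e2, ← hv, ← hw, e3, smul_zero, add_zero, zero_add,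
        mulVec_zero] at this
      exact (smul_eq_zero.1 this).resolve_right hu
    have x1 : x 1 = 0 := by
      have := congrArg (fun y => vecMulVec u φ *ᵥ (K *ᵥ (K *ᵥ y))) hx'
      simp only [mulVec_add, mulVec_smul, e0, e1, e2, ← hv, ← hw, e3, smul_zero, add_zero, zero_add,
        mulVec_zero] at this
      exact (smul_eq_zero.1 this).resolve_right hu
    apply hx0
    ext i
    fin_cases i <;> assumption
  · ext i j
    have : (K * of fun i j => ![u, v, w] j i) i j = (K *ᵥ (fun i => ![u, v, w] j i)) i := rfl
    rw [this, hcol, ← hv, ← hw, e3]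
    fin_cases j <;> simp [cyclicMatrix, mul_apply, Fin.sum_univ_three]
  · ext i j
    have : (vecMulVec u φ * of fun i j => ![u, v, w] j i) i j =
      (vecMulVec u φ *ᵥ (fun i => ![u, v, w] j i)) i := rfl
    rw [this, hcol, e0, e1, e2]
    fin_cases j <;> simp [mul_diagonal]

variable {ρ : TriangleGroup 3 3 4 →* Matrix.SpecialLinearGroup (Fin 3) ℂ}

theorem repMatrix_cube_k : repMatrix ρ (k 3 3 4) * (repMatrix ρ (k 3 3 4) * repMatrix ρ (k 3 3 4))
    = 1 := by
  rw [← repMatrix_mul, ← repMatrix_mul, k_mul_k, mul_inv_cancel, repMatrix_one]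

theorem repMatrix_cube_l : repMatrix ρ (l 3 3 4) * (repMatrix ρ (l 3 3 4) * repMatrix ρ (l 3 3 4))
    = 1 := by
  rw [← repMatrix_mul, ← repMatrix_mul, l_mul_l, mul_inv_cancel, repMatrix_one]

/-- An irreducible representation either has generic values on the generators, or its character is
one of three exceptional ones. -/
theorem IsIrreducibleRep.generic_or_exceptional (h : IsIrreducibleRep ρ) :
    HasGenericValues (slCharacter ρ) ∨ ∃ i, ∀ ρ' : TriangleGroup 3 3 4 →*
      Matrix.SpecialLinearGroup (Fin 3) ℂ, repMatrix ρ' (k 3 3 4) = cyclicMatrix →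
        repMatrix ρ' (l 3 3 4) = exceptionalMatrix (exceptionalEigenvalue i) →
        slCharacter ρ = slCharacter ρ' := by
  obtain ⟨k1, k2⟩ := trace_eq_zero_of_order_three (det_repMatrix ρ _) repMatrix_cube_k
    h.k_ne_smul_one
  obtain ⟨l1, l2⟩ := trace_eq_zero_of_order_three (det_repMatrix ρ _) repMatrix_cube_l
    h.l_ne_smul_one
  have hM4 : repMatrix ρ (k 3 3 4 * l 3 3 4) ^ 4 = 1 := by
    rw [← repMatrix_pow, k_mul_l_pow, repMatrix_one]
  rcases trace_eq_one_or_exists_idempotent (det_repMatrix ρ _) hM4 h.k_mul_l_ne_smul_one with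
    ⟨m1, m2⟩ | ⟨a, b, u, φ, hab, htr, hM⟩
  · left
    rw [Matrix.adjugate_eq_of_mul_eq_one (det_repMatrix ρ _) (repMatrix_mul_inv ρ _)] at m2
    rw [← repMatrix_mul, k_mul_k] at k2
    rw [← repMatrix_mul, l_mul_l] at l2
    exact ⟨k1, k2, l1, l2, m1, m2⟩
  right
  have hba : b - a ≠ 0 := sub_ne_zero.2 hab.symm
  have hPP : vecMulVec u φ * vecMulVec u φ = vecMulVec u φ := by
    rw [trace_vecMulVec] at htr
    rw [vecMulVec_mul, vecMul_vecMulVec, dotProduct_comm, htr, one_smul]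
  have hKM : repMatrix ρ (k 3 3 4) * (repMatrix ρ (k 3 3 4) * repMatrix ρ (k 3 3 4 * l 3 3 4)) =
      repMatrix ρ (l 3 3 4) := by
    rw [← repMatrix_mul, ← repMatrix_mul, ← mul_assoc, k_mul_k, inv_mul_cancel_left]
  -- From `l = k ^ 2 (k l)`: the traces of `l` and `k ^ 2` vanish, so only the rank one part of `k
  -- l` contributes.
  have t2 : (vecMulVec u φ * (repMatrix ρ (k 3 3 4) * repMatrix ρ (k 3 3 4))).trace = 0 := by
    rw [← hKM, hM, ← mul_assoc, mul_add, mul_smul_comm, mul_smul_comm, mul_one, trace_add,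
      trace_smul, trace_smul, k2, smul_zero, zero_add, smul_eq_zero, trace_mul_comm] at l1
    exact l1.resolve_left hba
  have hMl : repMatrix ρ (k 3 3 4 * l 3 3 4) * (repMatrix ρ (l 3 3 4) * repMatrix ρ (l 3 3 4)) =
      repMatrix ρ (k 3 3 4) := by
    rw [← repMatrix_mul, ← repMatrix_mul, l_mul_l, mul_inv_cancel_right]
  -- From `k = (k l) l ^ 2`: the quadratic equation of `k l`, multiplied by `l ^ 2`, expresses `(k
  -- l) k` through the traceless matrices `k` and `l ^ 2`.
  have t1 : (vecMulVec u φ * repMatrix ρ (k 3 3 4)).trace = 0 := by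
    have hMM : repMatrix ρ (k 3 3 4 * l 3 3 4) * repMatrix ρ (k 3 3 4 * l 3 3 4) =
        (a + b) • repMatrix ρ (k 3 3 4 * l 3 3 4) - (a * b) • 1 := by
      rw [hM]
      simp only [mul_add, add_mul, smul_mul_assoc, mul_smul_comm, mul_one, one_mul, hPP]
      module
    have e := congrArg trace (congrArg (· * (repMatrix ρ (l 3 3 4) * repMatrix ρ (l 3 3 4))) hMM)
    simp only [mul_assoc, sub_mul, smul_mul_assoc, one_mul] at e
    rw [hMl, trace_sub, trace_smul, trace_smul, l2, k1, smul_zero, smul_zero, sub_zero, hM, add_mul,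
      smul_mul_assoc, smul_mul_assoc, one_mul, trace_add, trace_smul, trace_smul, k1, smul_zero,
      zero_add, smul_eq_zero] at e
    exact e.resolve_left hba
  obtain ⟨Q, hQ, hKQ, hPQ⟩ := exists_cyclic_basis repMatrix_cube_k htr t1 t2
  have hMQ : repMatrix ρ (k 3 3 4 * l 3 3 4) * Q = Q * diagonal ![b, a, a] := by
    rw [hM, add_mul, smul_mul_assoc, smul_mul_assoc, one_mul, hPQ]
    ext i j
    simp only [Matrix.add_apply, Matrix.smul_apply, mul_diagonal]
    fin_cases j <;> simp <;> ring
  have hu : IsUnit Q.det := isUnit_iff_ne_zero.2 hQ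
  have hdet : b * a * a = 1 := by
    have := congrArg det hMQ
    rw [det_mul, det_mul, det_repMatrix, one_mul, det_diagonal, Fin.prod_univ_three] at this
    exact (mul_eq_left₀ hQ).1 this.symm
  have ha4 : a ^ 4 = 1 := by
    have hpow : ∀ n : ℕ, repMatrix ρ (k 3 3 4 * l 3 3 4) ^ n * Q = Q * diagonal ![b, a, a] ^ n := by
      intro n
      induction n with
      | zero => simp
      | succ n ih => rw [pow_succ, mul_assoc, hMQ, ← mul_assoc, ih, mul_assoc, ← pow_succ]
    have h4 := hpow 4
    rw [hM4, one_mul, diagonal_pow] at h4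
    have h5 : diagonal (![b, a, a] ^ 4) = 1 := by
      rw [← one_mul (diagonal _), ← nonsing_inv_mul Q hu, mul_assoc, ← h4, nonsing_inv_mul Q hu]
    simpa using congrFun (congrFun h5 1) 1
  have hb : b = a ^ 2 := by linear_combination a ^ 2 * hdet - b * ha4
  have ha1 : a ≠ 1 := by
    rintro rfl
    apply hab
    rw [hb]; norm_num
  obtain ⟨i, rfl⟩ := exists_exceptionalEigenvalue ha4 ha1
  refine ⟨i, fun ρ' hk hl => slCharacter_eq_of_intertwining hQ (by rw [hk]; exact hKQ) ?_⟩
  rw [hl, ← hKM, mul_assoc, mul_assoc, hMQ, hb, ← cyclicMatrix_mul_exceptionalMatrix,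
    ← mul_assoc Q, ← hKQ, mul_assoc, ← mul_assoc, ← mul_assoc, mul_assoc (repMatrix ρ (k 3 3 4)),
    repMatrix_cube_k, one_mul]

end Classification

/-! ### Zariski topology -/

section Zariski

variable {ι κ : Type*}

theorem ZariskiSpace.isClosed_setOf_eval_eq_zero (f : MvPolynomial ι ℂ) :
    IsClosed {x : ZariskiSpace ι | MvPolynomial.eval x f = 0} :=
  ZariskiSpace.isClosed_iff.2 ⟨{f}, by simp⟩

theorem ZariskiSpace.isClosed_setOf_apply_eq (i : ι) (c : ℂ) :
    IsClosed {x : ZariskiSpace ι | x i = c} := by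
  have h : ∀ x : ι → ℂ,
      MvPolynomial.eval x (MvPolynomial.X i - MvPolynomial.C c) = 0 ↔ x i = c := by
    intro x
    simp [sub_eq_zero]
  have e : {x : ZariskiSpace ι | x i = c} = {x : ZariskiSpace ι |
      MvPolynomial.eval x (MvPolynomial.X i - MvPolynomial.C c) = 0} :=
    Set.ext fun x => (h x).symm
  rw [e]
  exact ZariskiSpace.isClosed_setOf_eval_eq_zero _

/-- Makes the finite set of exceptional characters closed. -/
instance ZariskiSpace.instT1Space : T1Space (ZariskiSpace ι) := by
  refine ⟨fun x => ?_⟩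
  have : ({x} : Set (ZariskiSpace ι)) = ⋂ i, {y : ZariskiSpace ι | y i = x i} := by
    ext y
    simp only [Set.mem_singleton_iff, Set.mem_iInter, Set.mem_ofPred_eq]
    exact ⟨fun h i => by rw [h], fun h => funext h⟩
  rw [this]
  exact isClosed_iInter fun i => ZariskiSpace.isClosed_setOf_apply_eq i _

theorem ZariskiSpace.continuous_of_polynomial {f : ZariskiSpace ι → ZariskiSpace κ}
    (P : κ → MvPolynomial ι ℂ) (hf : ∀ x j, f x j = MvPolynomial.eval x (P j)) : Continuous f := by
  rw [continuous_iff_isClosed]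
  intro Z hZ
  obtain ⟨F, rfl⟩ := ZariskiSpace.isClosed_iff.1 hZ
  refine ZariskiSpace.isClosed_iff.2 ⟨MvPolynomial.bind₁ P '' F, ?_⟩
  have h1 : ∀ (x : ι → ℂ) (g : MvPolynomial κ ℂ), MvPolynomial.eval x (MvPolynomial.bind₁ P g) =
      MvPolynomial.eval (fun j => MvPolynomial.eval x (P j)) g := by
    intro x g
    have := MvPolynomial.aeval_bind₁ (R := ℂ) (S := ℂ) x P g
    simpa only [MvPolynomial.aeval_eq_eval] using this
  have h2 : ∀ (x : ZariskiSpace ι) (g : MvPolynomial κ ℂ),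
      MvPolynomial.eval x (MvPolynomial.bind₁ P g) = MvPolynomial.eval (f x) g := by
    intro x g
    rw [show f x = fun j => MvPolynomial.eval x (P j) from funext (hf x)]
    exact h1 x g
  ext x
  simp only [Set.mem_preimage, Set.mem_ofPred_eq, Set.forall_mem_image, h2]

theorem IsRegularMap.continuous {S : Set (ZariskiSpace ι)} {T : Set (ZariskiSpace κ)} {f : S → T}
    (hf : IsRegularMap f) : Continuous f := by
  choose P hP using hf
  have h := ZariskiSpace.continuous_of_polynomial
    (f := fun (x : ZariskiSpace ι) j => MvPolynomial.eval x (P j)) P fun _ _ => rfl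
  have e : (fun x => (f x : ZariskiSpace κ)) =
      (fun (x : ZariskiSpace ι) j => MvPolynomial.eval x (P j)) ∘ Subtype.val := by
    funext x
    exact funext fun j => hP j x
  refine continuous_induced_rng.2 ?_
  change Continuous fun x => (f x : ZariskiSpace κ)
  rw [e]
  exact h.comp continuous_subtype_val

theorem ZariskiSpace.exists_polynomial_of_mem_isOpen {U : Set (ZariskiSpace ι)} (hU : IsOpen U)
    {x : ZariskiSpace ι} (hx : x ∈ U) : ∃ f : MvPolynomial ι ℂ, MvPolynomial.eval x f ≠ 0 ∧
      ∀ y : ZariskiSpace ι, MvPolynomial.eval y f ≠ 0 → y ∈ U := by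
  obtain ⟨F, hF⟩ := ZariskiSpace.isClosed_iff.1 hU.isClosed_compl
  have hx' : x ∉ Uᶜ := fun h => h hx
  rw [hF] at hx'
  simp only [Set.mem_ofPred_eq, not_forall] at hx'
  obtain ⟨f, hf, hfx⟩ := hx'
  refine ⟨f, hfx, fun y hy => ?_⟩
  by_contra hyU
  have : y ∈ Uᶜ := hyU
  rw [hF] at this
  exact hy (this f hf)

theorem ZariskiSpace.isPreirreducible_of_polynomial {S : Set (ZariskiSpace ι)}
    (h : ∀ f g : MvPolynomial ι ℂ, (∃ x ∈ S, MvPolynomial.eval x f ≠ 0) →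
      (∃ x ∈ S, MvPolynomial.eval x g ≠ 0) →
      ∃ x ∈ S, MvPolynomial.eval x f ≠ 0 ∧ MvPolynomial.eval x g ≠ 0) : IsPreirreducible S := by
  rintro U V hU hV ⟨x, hxS, hxU⟩ ⟨y, hyS, hyV⟩
  obtain ⟨f, hf, hfU⟩ := ZariskiSpace.exists_polynomial_of_mem_isOpen hU hxU
  obtain ⟨g, hg, hgV⟩ := ZariskiSpace.exists_polynomial_of_mem_isOpen hV hyV
  obtain ⟨z, hz, hzf, hzg⟩ := h f g ⟨x, hxS, hf⟩ ⟨y, hyS, hg⟩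
  exact ⟨z, hz, hfU z hzf, hgV z hzg⟩

/-- By the Nullstellensatz, a polynomial that vanishes on the zero set of a prime `f` is divisible
by `f`. -/
theorem ZariskiSpace.isPreirreducible_setOf_eval_eq_zero [Finite ι] {f : MvPolynomial ι ℂ}
    (hf : Prime f) : IsPreirreducible {x : ZariskiSpace ι | MvPolynomial.eval x f = 0} := by
  have hprime : (Ideal.span {f}).IsPrime := (Ideal.span_singleton_prime hf.ne_zero).2 hf
  have key : ∀ g : MvPolynomial ι ℂ,
      (∀ x : ZariskiSpace ι, MvPolynomial.eval x f = 0 → MvPolynomial.eval x g = 0) → f ∣ g := by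
    intro g hg
    rw [← Ideal.mem_span_singleton,
      ← MvPolynomial.IsPrime.vanishingIdeal_zeroLocus (K := ℂ) (Ideal.span {f})]
    intro x hx
    exact hg x (hx f (Ideal.mem_span_singleton_self f))
  apply ZariskiSpace.isPreirreducible_of_polynomial
  rintro g h ⟨x, hx, hgx⟩ ⟨y, hy, hhy⟩
  by_contra! hcon
  rcases hf.dvd_or_dvd (key (g * h) fun z hz => by
    rw [map_mul, mul_eq_zero, or_iff_not_imp_left]
    exact hcon z hz) with ⟨q, rfl⟩ | ⟨q, rfl⟩
  · rw [map_mul, hx, zero_mul] at hgx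
    exact hgx rfl
  · rw [map_mul, hy, zero_mul] at hhy
    exact hhy rfl

/-- The polynomial map of the affine line with given coordinates. -/
noncomputable def ZariskiSpace.curve (c : ι → Polynomial ℂ) (t : ℂ) : ZariskiSpace ι :=
  fun i => (c i).eval t

/-- Polynomials pull back to `ℂ[X]`, a domain, where a nonzero product has a point at which it does
not vanish. -/
theorem ZariskiSpace.isIrreducible_range_curve (c : ι → Polynomial ℂ) :
    IsIrreducible (Set.range (ZariskiSpace.curve c)) := by
  refine ⟨Set.range_nonempty _, ZariskiSpace.isPreirreducible_of_polynomial ?_⟩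
  have e : ∀ (f : MvPolynomial ι ℂ) (t : ℂ),
      MvPolynomial.eval (ZariskiSpace.curve c t) f = (MvPolynomial.aeval c f).eval t := by
    intro f t
    have := MvPolynomial.comp_aeval_apply c (Polynomial.aeval t : Polynomial ℂ →ₐ[ℂ] ℂ) f
    rw [Polynomial.coe_aeval_eq_eval] at this
    rw [this]
    rfl
  rintro f g ⟨_, ⟨s, rfl⟩, hs⟩ ⟨_, ⟨t, rfl⟩, ht⟩
  have hfg : MvPolynomial.aeval c f * MvPolynomial.aeval c g ≠ 0 := by
    apply mul_ne_zero
    · rintro h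
      rw [e, h, Polynomial.eval_zero] at hs
      exact hs rfl
    · rintro h
      rw [e, h, Polynomial.eval_zero] at ht
      exact ht rfl
  obtain ⟨r, hr⟩ : ∃ r, (MvPolynomial.aeval c f * MvPolynomial.aeval c g).eval r ≠ 0 := by
    by_contra! hcon
    exact hfg (Polynomial.funext fun r => by rw [hcon, Polynomial.eval_zero])
  rw [Polynomial.eval_mul] at hr
  exact ⟨_, ⟨r, rfl⟩, by rw [e]; exact left_ne_zero_of_mul hr, by rw [e]; exact right_ne_zero_of_mul hr⟩

/-- The dimension of the zero set of a nonzero polynomial is less than that of the ambient space. -/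
theorem ZariskiSpace.topologicalKrullDim_add_one_le {n : ℕ} {f : MvPolynomial (Fin n) ℂ}
    (hf : f ≠ 0) {S : Set (ZariskiSpace (Fin n))} (hS : ∀ x ∈ S, MvPolynomial.eval x f = 0) :
    topologicalKrullDim S + 1 ≤ n := by
  have hsurj := Ideal.Quotient.mk_surjective (I := Ideal.span {f})
  -- The points of `S` factor through the closed subspace `Spec (ℂ[X] / (f))`. So `S` carries the
  -- topology induced from it, and its dimension is bounded by that of a quotient by a
  -- nonzerodivisor.
  have hmem : ∀ x : S,
      ∃ y : PrimeSpectrum (MvPolynomial (Fin n) ℂ ⧸ Ideal.span {f}),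
        PrimeSpectrum.comap (Ideal.Quotient.mk (Ideal.span {f})) y =
          MvPolynomial.pointToPoint (k := ℂ) (K := ℂ) x.1 := by
    intro x
    rw [← Set.mem_range, range_comap_of_surjective _ _ hsurj, Ideal.mk_ker,
      PrimeSpectrum.mem_zeroLocus]
    refine Ideal.span_le.2 (Set.singleton_subset_iff.2 ?_)
    rintro _ rfl
    exact hS x.1 x.2
  choose ψ hψ using hmem
  have hemb := PrimeSpectrum.isClosedEmbedding_comap_of_surjective _ _ hsurj
  have hind : Topology.IsInducing ψ := by
    rw [← hemb.isInducing.of_comp_iff]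
    have : Topology.IsInducing
        (fun x : ZariskiSpace (Fin n) => MvPolynomial.pointToPoint (k := ℂ) (K := ℂ) x) := ⟨rfl⟩
    convert this.comp Topology.IsInducing.subtypeVal using 1
    exact funext hψ
  have h1 := hind.topologicalKrullDim_le
  rw [PrimeSpectrum.topologicalKrullDim_eq_ringKrullDim] at h1
  have h2 := ringKrullDim_quotient_succ_le_of_nonZeroDivisor (mem_nonZeroDivisors_of_ne_zero hf)
  rw [MvPolynomial.ringKrullDim_of_isNoetherianRing, ringKrullDim_eq_zero_of_field, zero_add,
    Nat.card_fin] at h2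
  exact le_trans (by gcongr) h2

end Zariski

/-! ### Geometry of the hypersurface -/

section Hypersurface

/-- The polynomial that defines the hypersurface. -/
noncomputable def polynomialD334 : MvPolynomial (Fin 3) ℂ :=
  MvPolynomial.X 2 ^ 2 - (MvPolynomial.X 0 * MvPolynomial.X 1 - 2) * MvPolynomial.X 2
    + MvPolynomial.X 0 ^ 3 + MvPolynomial.X 1 ^ 3 - 5 * (MvPolynomial.X 0 * MvPolynomial.X 1) + 5

theorem hypersurfaceD334_eq : hypersurfaceD334 =
    {x : ZariskiSpace (Fin 3) | MvPolynomial.eval x polynomialD334 = 0} := by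
  have h : ∀ x : Fin 3 → ℂ, MvPolynomial.eval x polynomialD334 =
      (x 2) ^ 2 - (x 0 * x 1 - 2) * x 2 + (x 0) ^ 3 + (x 1) ^ 3 - 5 * (x 0 * x 1) + 5 := by
    intro x
    simp [polynomialD334]
  exact Set.ext fun x => (Iff.of_eq (congrArg (· = 0) (h x))).symm

theorem isClosed_hypersurfaceD334 : IsClosed hypersurfaceD334 := by
  rw [hypersurfaceD334_eq]
  exact ZariskiSpace.isClosed_setOf_eval_eq_zero _

/-- As a monic cubic in `ν`, it is reducible only if it has a root in `ℂ[ν', ζ]`. At `ν' = 0` the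
cube of a root would equal a polynomial in `ζ` of degree `2`, which is not a multiple of three. -/
theorem irreducible_polynomialD334 : Irreducible polynomialD334 := by
  rw [← MulEquiv.irreducible_iff (MvPolynomial.finSuccEquiv ℂ 2)]
  have e : MvPolynomial.finSuccEquiv ℂ 2 polynomialD334 = Polynomial.X ^ 3
      - Polynomial.C (MvPolynomial.X 0 * (MvPolynomial.X 1 + 5)) * Polynomial.X
      + Polynomial.C (MvPolynomial.X 1 ^ 2 + 2 * MvPolynomial.X 1 + MvPolynomial.X 0 ^ 3 + 5) := by
    have h0 : MvPolynomial.finSuccEquiv ℂ 2 (MvPolynomial.X 0) = Polynomial.X :=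
      MvPolynomial.finSuccEquiv_X_zero
    have h1 : MvPolynomial.finSuccEquiv ℂ 2 (MvPolynomial.X 1) =
      Polynomial.C (MvPolynomial.X 0) := MvPolynomial.finSuccEquiv_X_succ (j := 0)
    have h2 : MvPolynomial.finSuccEquiv ℂ 2 (MvPolynomial.X 2) =
      Polynomial.C (MvPolynomial.X 1) := MvPolynomial.finSuccEquiv_X_succ (j := 1)
    simp only [polynomialD334, map_add, map_sub, map_mul, map_pow, h0, h1, h2, map_ofNat]
    ring
  rw [e]
  have hdeg : (Polynomial.X ^ 3
      - Polynomial.C (MvPolynomial.X 0 * (MvPolynomial.X 1 + 5)) * Polynomial.X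
      + Polynomial.C (MvPolynomial.X 1 ^ 2 + 2 * MvPolynomial.X 1 + MvPolynomial.X 0 ^ 3 + 5) :
        Polynomial (MvPolynomial (Fin 2) ℂ)).natDegree = 3 := by compute_degree!
  have hmon : (Polynomial.X ^ 3
      - Polynomial.C (MvPolynomial.X 0 * (MvPolynomial.X 1 + 5)) * Polynomial.X
      + Polynomial.C (MvPolynomial.X 1 ^ 2 + 2 * MvPolynomial.X 1 + MvPolynomial.X 0 ^ 3 + 5) :
        Polynomial (MvPolynomial (Fin 2) ℂ)).Monic := by monicity!
  rw [hmon.irreducible_iff_roots_eq_zero_of_degree_le_three (by omega) (by omega),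
    Multiset.eq_zero_iff_forall_notMem]
  intro p hp
  have hroot := (Polynomial.mem_roots'.1 hp).2
  rw [Polynomial.IsRoot] at hroot
  simp only [Polynomial.eval_add, Polynomial.eval_sub, Polynomial.eval_mul, Polynomial.eval_pow,
    Polynomial.eval_X, Polynomial.eval_C] at hroot
  obtain ⟨q, hq⟩ : ∃ q, q = MvPolynomial.aeval ![(0 : Polynomial ℂ), Polynomial.X] p := ⟨_, rfl⟩
  have := congrArg (MvPolynomial.aeval ![(0 : Polynomial ℂ), Polynomial.X]) hroot
  simp only [map_add, map_sub, map_mul, map_pow, MvPolynomial.aeval_X, map_ofNat, map_zero,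
    ← hq, Matrix.cons_val_zero, Matrix.cons_val_one] at this
  have hq3 : q ^ 3 = -(Polynomial.X ^ 2 + 2 * Polynomial.X + 5) := by linear_combination this
  have hd := congrArg Polynomial.natDegree hq3
  have hd2 : (Polynomial.X ^ 2 + 2 * Polynomial.X + 5 : Polynomial ℂ).natDegree = 2 := by
    compute_degree!
  rw [Polynomial.natDegree_pow, Polynomial.natDegree_neg, hd2] at hd
  omega

theorem isIrreducible_hypersurfaceD334 : IsIrreducible hypersurfaceD334 := by
  refine ⟨⟨![2, 2, 1], ?_⟩, ?_⟩
  · change (1 : ℂ) ^ 2 - (2 * 2 - 2) * 1 + 2 ^ 3 + 2 ^ 3 - 5 * (2 * 2) + 5 = 0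
    norm_num
  · rw [hypersurfaceD334_eq]
    exact ZariskiSpace.isPreirreducible_setOf_eval_eq_zero irreducible_polynomialD334.prime

/-- A line on the hypersurface. -/
def lineD334 : Set (ZariskiSpace (Fin 3)) := {x | x 0 + x 1 = -2 ∧ x 2 = 1}

theorem lineD334_eq :
    lineD334 = Set.range (ZariskiSpace.curve ![Polynomial.X, -2 - Polynomial.X, 1]) := by
  ext x
  constructor
  · rintro ⟨h1, h2⟩
    refine ⟨x 0, funext fun i => ?_⟩
    fin_cases i
    · simp [ZariskiSpace.curve]
    · simp [ZariskiSpace.curve]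
      linear_combination -h1
    · simp [ZariskiSpace.curve, h2]
  · rintro ⟨t, rfl⟩
    constructor <;> simp [ZariskiSpace.curve]

theorem isClosed_lineD334 : IsClosed lineD334 := by
  have h : ∀ x : Fin 3 → ℂ, MvPolynomial.eval x (MvPolynomial.X 0 + MvPolynomial.X 1 + 2) = 0 ↔
      x 0 + x 1 = -2 := by
    intro x
    simp [add_eq_zero_iff_eq_neg]
  have e : lineD334 = {x : ZariskiSpace (Fin 3) |
      MvPolynomial.eval x (MvPolynomial.X 0 + MvPolynomial.X 1 + 2) = 0} ∩ {x | x 2 = 1} :=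
    Set.ext fun x => and_congr_left' (h x).symm
  rw [e]
  exact (ZariskiSpace.isClosed_setOf_eval_eq_zero _).inter (ZariskiSpace.isClosed_setOf_apply_eq _ _)

theorem lineD334_subset : lineD334 ⊆ hypersurfaceD334 := by
  rintro x ⟨h1, h2⟩
  change (x 2) ^ 2 - (x 0 * x 1 - 2) * x 2 + (x 0) ^ 3 + (x 1) ^ 3 - 5 * (x 0 * x 1) + 5 = 0
  rw [h2, eq_sub_of_add_eq' h1]
  ring

theorem isIrreducible_lineD334 : IsIrreducible lineD334 := by
  rw [lineD334_eq]
  exact ZariskiSpace.isIrreducible_range_curve _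

theorem IsIrreducible.preimage_subtype_val {X : Type*} [TopologicalSpace X] {S Z : Set X}
    (hZ : IsIrreducible Z) (h : Z ⊆ S) : IsIrreducible (Subtype.val ⁻¹' Z : Set S) := by
  obtain ⟨z, hz⟩ := hZ.nonempty
  refine ⟨⟨⟨z, h hz⟩, hz⟩, ?_⟩
  rintro _ _ ⟨U, hU, rfl⟩ ⟨V, hV, rfl⟩ ⟨x, hx, hxU⟩ ⟨y, hy, hyV⟩
  obtain ⟨w, hw, hwU, hwV⟩ := hZ.isPreirreducible U V hU hV ⟨x, hx, hxU⟩ ⟨y, hy, hyV⟩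
  exact ⟨⟨w, h hw⟩, hw, hwU, hwV⟩

/-- An irreducible closed subset that lies in `S`, as an irreducible closed subset of `S`. -/
def irreducibleClosedsOfSubset {X : Type*} [TopologicalSpace X] {S Z : Set X} (hZ : IsIrreducible Z)
    (hc : IsClosed Z) (h : Z ⊆ S) : TopologicalSpace.IrreducibleCloseds S where
  carrier := Subtype.val ⁻¹' Z
  isIrreducible' := hZ.preimage_subtype_val h
  isClosed' := hc.preimage continuous_subtype_val

theorem irreducibleClosedsOfSubset_lt {X : Type*} [TopologicalSpace X] {S Z Z' : Set X}
    {hZ : IsIrreducible Z} {hc : IsClosed Z} {h : Z ⊆ S} {hZ' : IsIrreducible Z'}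
    {hc' : IsClosed Z'} {h' : Z' ⊆ S} (hlt : Z ⊂ Z') :
    irreducibleClosedsOfSubset hZ hc h < irreducibleClosedsOfSubset hZ' hc' h' := by
  refine lt_of_le_not_ge (fun x hx => hlt.1 hx) fun hle => hlt.2 fun x hx => ?_
  exact hle (show (⟨x, h' hx⟩ : S) ∈ irreducibleClosedsOfSubset hZ' hc' h' from hx)

/-- The upper bound is that of a proper zero set in `ℂ³`; the lower bound comes from the chain
point, line, hypersurface. -/
theorem topologicalKrullDim_hypersurfaceD334 : topologicalKrullDim hypersurfaceD334 = 2 := by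
  apply le_antisymm
  · have := ZariskiSpace.topologicalKrullDim_add_one_le irreducible_polynomialD334.ne_zero
      (S := hypersurfaceD334) (fun x hx => by rwa [hypersurfaceD334_eq] at hx)
    by_contra! hlt
    have h3 : ((2 : ℕ) : WithBot ℕ∞) + 1 ≤ topologicalKrullDim hypersurfaceD334 :=
      ENat.WithBot.add_one_le_iff.2 (by exact_mod_cast hlt)
    have h4 : ((2 : ℕ) : WithBot ℕ∞) + 1 + 1 ≤ (3 : ℕ) := le_trans (by gcongr) this
    norm_cast at h4
  · obtain ⟨p, hp⟩ : ∃ p : ZariskiSpace (Fin 3), p = ![0, -2, 1] := ⟨_, rfl⟩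
    have hpl : p ∈ lineD334 := by constructor <;> simp [hp]
    have h1 : {p} ⊂ lineD334 := by
      refine ⟨Set.singleton_subset_iff.2 hpl, fun h => ?_⟩
      have q : (![-2, 0, 1] : ZariskiSpace (Fin 3)) ∈ lineD334 := by constructor <;> simp
      have := congrFun ((Set.mem_singleton_iff.1 (h q)).trans hp) 0
      simp at this
    have h2 : lineD334 ⊂ hypersurfaceD334 := by
      refine ⟨lineD334_subset, fun h => ?_⟩
      have q : (![-5, 0, 10] : ZariskiSpace (Fin 3)) ∈ hypersurfaceD334 := by
        change (10 : ℂ) ^ 2 - (-5 * 0 - 2) * 10 + (-5) ^ 3 + 0 ^ 3 - 5 * (-5 * 0) + 5 = 0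
        norm_num
      have := (h q).2
      change (10 : ℂ) = 1 at this
      norm_num at this
    let A : TopologicalSpace.IrreducibleCloseds hypersurfaceD334 :=
      irreducibleClosedsOfSubset isIrreducible_singleton isClosed_singleton
      (h1.1.trans h2.1)
    let B : TopologicalSpace.IrreducibleCloseds hypersurfaceD334 :=
      irreducibleClosedsOfSubset isIrreducible_lineD334 isClosed_lineD334 h2.1
    let C : TopologicalSpace.IrreducibleCloseds hypersurfaceD334 :=
      irreducibleClosedsOfSubset isIrreducible_hypersurfaceD334 isClosed_hypersurfaceD334
      (subset_refl hypersurfaceD334)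
    have hAB : A < B := irreducibleClosedsOfSubset_lt h1
    have hBC : B < C := irreducibleClosedsOfSubset_lt h2
    let c : LTSeries (TopologicalSpace.IrreducibleCloseds hypersurfaceD334) :=
      ⟨2, ![A, B, C], fun i => by
        fin_cases i
        · exact hAB
        · exact hBC⟩
    exact Order.LTSeries.length_le_krullDim c

end Hypersurface

/-! ### The component of dimension two -/

section Component

open TriangleGroup

/-- A polynomial that expresses the trace of `γ` in the parameters, on the component. -/
noncomputable def tracePolynomial (γ : TriangleGroup 3 3 4) : MvPolynomial (Fin 3) ℂ :=
  (exists_polynomial_slCharacter γ).choose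

/-- The inverse of the parametrization of the component. -/
noncomputable def ofParametersD334 (x : ZariskiSpace (Fin 3)) : ZariskiSpace (TriangleGroup 3 3 4) :=
  fun γ => MvPolynomial.eval x (tracePolynomial γ)

theorem ofParametersD334_parametersD334 {χ : ZariskiSpace (TriangleGroup 3 3 4)}
    (h : χ ∈ componentD334) : ofParametersD334 (parametersD334 χ) = χ := by
  obtain ⟨⟨ρ, rfl⟩, h⟩ := h
  exact funext fun γ => ((exists_polynomial_slCharacter γ).choose_spec ρ h).symm

theorem ofParametersD334_mem {x : ZariskiSpace (Fin 3)} (hx : x ∈ hypersurfaceD334) :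
    ofParametersD334 x ∈ componentD334 := by
  obtain ⟨χ, hχ, rfl⟩ := exists_mem_componentD334 hx
  rwa [ofParametersD334_parametersD334 hχ]

theorem parametersD334_ofParametersD334 {x : ZariskiSpace (Fin 3)} (hx : x ∈ hypersurfaceD334) :
    parametersD334 (ofParametersD334 x) = x := by
  obtain ⟨χ, hχ, rfl⟩ := exists_mem_componentD334 hx
  rw [ofParametersD334_parametersD334 hχ]

theorem continuous_ofParametersD334 : Continuous ofParametersD334 :=
  ZariskiSpace.continuous_of_polynomial tracePolynomial fun _ _ => rfl

theorem image_ofParametersD334 : ofParametersD334 '' hypersurfaceD334 = componentD334 := by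
  ext χ
  constructor
  · rintro ⟨x, hx, rfl⟩
    exact ofParametersD334_mem hx
  · exact fun h => ⟨_, parametersD334_mem h, ofParametersD334_parametersD334 h⟩

theorem isIrreducible_componentD334 : IsIrreducible componentD334 := by
  rw [← image_ofParametersD334]
  exact isIrreducible_hypersurfaceD334.image _ continuous_ofParametersD334.continuousOn

/-- The parameters as polynomials in the coordinates. -/
noncomputable def parameterPolynomial :
    Fin 3 → MvPolynomial (TriangleGroup 3 3 4) ℂ :=
  ![MvPolynomial.X ((k 3 3 4)⁻¹ * l 3 3 4), MvPolynomial.X (k 3 3 4 * (l 3 3 4)⁻¹),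
    MvPolynomial.X (k 3 3 4 * l 3 3 4 * (k 3 3 4)⁻¹ * (l 3 3 4)⁻¹)]

theorem parametersD334_apply (χ : ZariskiSpace (TriangleGroup 3 3 4)) (j : Fin 3) :
    parametersD334 χ j = MvPolynomial.eval χ (parameterPolynomial j) := by
  have h (γ : TriangleGroup 3 3 4) : χ γ = MvPolynomial.eval χ (MvPolynomial.X γ) :=
    (MvPolynomial.eval_X (f := χ) γ).symm
  fin_cases j
  · exact h ((k 3 3 4)⁻¹ * l 3 3 4)
  · exact h (k 3 3 4 * (l 3 3 4)⁻¹)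
  · exact h (k 3 3 4 * l 3 3 4 * (k 3 3 4)⁻¹ * (l 3 3 4)⁻¹)

theorem continuous_parametersD334 : Continuous parametersD334 :=
  ZariskiSpace.continuous_of_polynomial parameterPolynomial parametersD334_apply

/-- The component consists of the points whose parameters lie on the hypersurface and whose
coordinates are the trace polynomials of these parameters. These conditions are polynomial, although
being a character is not visibly so. -/
theorem isClosed_componentD334 : IsClosed componentD334 := by
  have e : componentD334 = parametersD334 ⁻¹' hypersurfaceD334 ∩
      ⋂ γ, {χ : ZariskiSpace (TriangleGroup 3 3 4) | MvPolynomial.eval χ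
        (MvPolynomial.bind₁ parameterPolynomial (tracePolynomial γ) - MvPolynomial.X γ) = 0} := by
    have h (χ : TriangleGroup 3 3 4 → ℂ) (γ : TriangleGroup 3 3 4) : MvPolynomial.eval χ
        (MvPolynomial.bind₁ parameterPolynomial (tracePolynomial γ) - MvPolynomial.X γ) =
        ofParametersD334 (parametersD334 χ) γ - χ γ := by
      have := MvPolynomial.aeval_bind₁ (R := ℂ) (S := ℂ) χ parameterPolynomial (tracePolynomial γ)
      simp only [MvPolynomial.aeval_eq_eval] at this
      rw [map_sub, MvPolynomial.eval_X, this, ofParametersD334,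
        show parametersD334 χ = _ from funext (parametersD334_apply χ)]
    ext χ
    rw [Set.mem_inter_iff, Set.mem_iInter]
    constructor
    · refine fun hχ => ⟨parametersD334_mem hχ, fun γ => ?_⟩
      refine (h χ γ).trans ?_
      rw [ofParametersD334_parametersD334 hχ, sub_self]
    · rintro ⟨hχ, h'⟩
      rw [← show ofParametersD334 (parametersD334 χ) = χ from
        funext fun γ => sub_eq_zero.1 ((h χ γ).symm.trans (h' γ))]
      exact ofParametersD334_mem hχ
  rw [e]
  exact (isClosed_hypersurfaceD334.preimage continuous_parametersD334).inter
    (isClosed_iInter fun γ => ZariskiSpace.isClosed_setOf_eval_eq_zero _)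

/-- The parametrization of the component by the hypersurface. -/
noncomputable def componentEquivD334 : componentD334 ≃ hypersurfaceD334 where
  toFun χ := ⟨parametersD334 χ, parametersD334_mem χ.2⟩
  invFun x := ⟨ofParametersD334 x, ofParametersD334_mem x.2⟩
  left_inv χ := Subtype.ext (ofParametersD334_parametersD334 χ.2)
  right_inv x := Subtype.ext (parametersD334_ofParametersD334 x.2)

theorem isRegularMap_componentEquivD334 : IsRegularMap componentEquivD334 :=
  fun j => ⟨parameterPolynomial j, fun χ => parametersD334_apply χ j⟩

theorem isRegularMap_componentEquivD334_symm : IsRegularMap componentEquivD334.symm :=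
  fun γ => ⟨tracePolynomial γ, fun _ => rfl⟩

theorem topologicalKrullDim_componentD334 : topologicalKrullDim componentD334 = 2 := by
  let e : componentD334 ≃ₜ hypersurfaceD334 :=
    { componentEquivD334 with
      continuous_toFun := isRegularMap_componentEquivD334.continuous
      continuous_invFun := isRegularMap_componentEquivD334_symm.continuous }
  rw [e.isHomeomorph.topologicalKrullDim_eq, topologicalKrullDim_hypersurfaceD334]

/-- All reducible characters of the component satisfy `ζ = 1`. Were some point outside the closure,
irreducibility of the component would give another one with `ζ ≠ 1`, which is an irreducible
character. The point `(-5, 0, 10)` shows that `ζ ≠ 1` does occur. -/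
theorem componentD334_subset_closure :
    componentD334 ⊆ closure (irreducibleCharacters (TriangleGroup 3 3 4) 3) := by
  intro χ hχ
  by_contra hn
  have hU : IsOpen {χ : ZariskiSpace (TriangleGroup 3 3 4) |
      χ (k 3 3 4 * l 3 3 4 * (k 3 3 4)⁻¹ * (l 3 3 4)⁻¹) = 1}ᶜ :=
    (ZariskiSpace.isClosed_setOf_apply_eq _ _).isOpen_compl
  obtain ⟨χ₁, hχ₁, h₁⟩ := exists_mem_componentD334 (x := ![-5, 0, 10]) (by
    change (10 : ℂ) ^ 2 - (-5 * 0 - 2) * 10 + (-5) ^ 3 + 0 ^ 3 - 5 * (-5 * 0) + 5 = 0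
    norm_num)
  obtain ⟨χ₂, hχ₂, hirr, hne⟩ := isIrreducible_componentD334.isPreirreducible _ _
    isClosed_closure.isOpen_compl hU ⟨χ, hχ, hn⟩ ⟨χ₁, hχ₁, fun h => by
      have h' := (congrFun h₁ 2).symm.trans h
      change (10 : ℂ) = 1 at h'
      norm_num at h'⟩
  obtain ⟨c, -, hc⟩ := (notMem_irreducibleCharacters_iff hχ₂).1 fun h => hirr (subset_closure h)
  exact hne (congrFun hc 2)

end Component

/-! ### The isolated points -/

section Isolated

open TriangleGroup

/-- The representations with isolated characters. -/
noncomputable def exceptionalRep (i : Fin 3) :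
    TriangleGroup 3 3 4 →* Matrix.SpecialLinearGroup (Fin 3) ℂ :=
  (exists_exceptional_representation (exceptionalEigenvalue_pow_four i)).choose

theorem repMatrix_exceptionalRep_k (i : Fin 3) :
    repMatrix (exceptionalRep i) (k 3 3 4) = cyclicMatrix :=
  (exists_exceptional_representation (exceptionalEigenvalue_pow_four i)).choose_spec.1

theorem repMatrix_exceptionalRep_l (i : Fin 3) :
    repMatrix (exceptionalRep i) (l 3 3 4) = exceptionalMatrix (exceptionalEigenvalue i) :=
  (exists_exceptional_representation (exceptionalEigenvalue_pow_four i)).choose_spec.2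

/-- The isolated characters. -/
noncomputable def exceptionalCharacter (i : Fin 3) : ZariskiSpace (TriangleGroup 3 3 4) :=
  slCharacter (exceptionalRep i)

theorem exceptionalCharacter_mul (i : Fin 3) : exceptionalCharacter i (k 3 3 4 * l 3 3 4) =
    exceptionalEigenvalue i ^ 2 + 2 * exceptionalEigenvalue i :=
  slCharacter_mul_of_exceptional (repMatrix_exceptionalRep_k i) (repMatrix_exceptionalRep_l i)

theorem exceptionalCharacter_injective : Function.Injective exceptionalCharacter := fun i j h =>
  exceptional_trace_injective (by
    simpa only [exceptionalCharacter_mul] using congrFun h (k 3 3 4 * l 3 3 4))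

theorem exceptionalCharacter_notMem (i : Fin 3) : exceptionalCharacter i ∉ componentD334 := fun h =>
  exceptional_trace_ne_one i ((exceptionalCharacter_mul i).symm.trans h.2.2.2.2.2.1)

theorem exceptionalCharacter_mem_irreducibleCharacters (i : Fin 3) :
    exceptionalCharacter i ∈ irreducibleCharacters (TriangleGroup 3 3 4) 3 :=
  ⟨_, isIrreducibleRep_of_exceptional (exceptionalEigenvalue_pow_four i)
    (exceptionalEigenvalue_ne_one i) (repMatrix_exceptionalRep_k i)
    (repMatrix_exceptionalRep_l i), rfl⟩

theorem irreducibleCharacters_subset : irreducibleCharacters (TriangleGroup 3 3 4) 3 ⊆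
    componentD334 ∪ Set.range exceptionalCharacter := by
  rintro _ ⟨ρ, hρ, rfl⟩
  rcases hρ.generic_or_exceptional with h | ⟨i, h⟩
  · exact Or.inl ⟨⟨ρ, rfl⟩, h⟩
  · exact Or.inr ⟨i, (h _ (repMatrix_exceptionalRep_k i) (repMatrix_exceptionalRep_l i)).symm⟩

/-- The right side is already closed in the whole affine space and consists of characters, so
intersecting with the variety of characters removes nothing. -/
theorem closureIrreducibleCharacters_eq : closureIrreducibleCharacters (TriangleGroup 3 3 4) 3 =
    componentD334 ∪ Set.range exceptionalCharacter := by
  apply Set.Subset.antisymm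
  · exact Set.inter_subset_left.trans (closure_minimal irreducibleCharacters_subset
      (isClosed_componentD334.union (Set.finite_range _).isClosed))
  · apply Set.union_subset
    · exact fun χ hχ => ⟨componentD334_subset_closure hχ, hχ.1⟩
    · rintro _ ⟨i, rfl⟩
      exact ⟨subset_closure (exceptionalCharacter_mem_irreducibleCharacters i), _, rfl⟩

theorem isComponentOf_componentD334 :
    IsComponentOf componentD334 (closureIrreducibleCharacters (TriangleGroup 3 3 4) 3) := by
  rw [closureIrreducibleCharacters_eq]
  refine ⟨⟨Set.subset_union_left, isIrreducible_componentD334⟩, ?_⟩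
  rintro S ⟨hS, hirr⟩ hle
  rcases isPreirreducible_iff_isClosed_union_isClosed.1 hirr.isPreirreducible _ _
    isClosed_componentD334 (Set.finite_range exceptionalCharacter).isClosed hS with h | h
  · exact h
  · obtain ⟨χ, hχ⟩ := isIrreducible_componentD334.nonempty
    obtain ⟨i, rfl⟩ := h (hle hχ)
    exact absurd hχ (exceptionalCharacter_notMem i)

theorem isIsolatedPointOf_exceptionalCharacter (i : Fin 3) : IsIsolatedPointOf
    (exceptionalCharacter i) (closureIrreducibleCharacters (TriangleGroup 3 3 4) 3) := by
  rw [closureIrreducibleCharacters_eq]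
  refine ⟨(componentD334 ∪ exceptionalCharacter '' {i}ᶜ)ᶜ, (isClosed_componentD334.union
    ((Set.toFinite {i}ᶜ).image exceptionalCharacter).isClosed).isOpen_compl, ?_⟩
  ext χ
  constructor
  · rintro ⟨hn, h | ⟨j, rfl⟩⟩
    · exact absurd (Or.inl h) hn
    · by_contra hne
      exact hn (Or.inr ⟨j, fun h => hne (congrArg exceptionalCharacter h), rfl⟩)
  · rintro rfl
    refine ⟨?_, Or.inr ⟨i, rfl⟩⟩
    rintro (h | ⟨j, hj, h⟩)
    · exact exceptionalCharacter_notMem i h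
    · exact hj (exceptionalCharacter_injective h)

end Isolated

theorem exists_cube_eq_one_iff {ω : ℂ} (hω : IsPrimitiveRoot ω 3) (p : ℂ → Prop) :
    (∃ c : ℂ, c ^ 3 = 1 ∧ p c) ↔ p 1 ∨ p ω ∨ p (ω ^ 2) := by
  constructor
  · rintro ⟨c, hc, h⟩
    obtain ⟨i, hi, rfl⟩ := hω.eq_pow_of_pow_eq_one hc
    interval_cases i
    · exact Or.inl (by simpa using h)
    · exact Or.inr (Or.inl (by simpa using h))
    · exact Or.inr (Or.inr h)
  · rintro (h | h | h)
    · exact ⟨1, one_pow _, h⟩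
    · exact ⟨ω, hω.pow_eq_one, h⟩
    · exact ⟨ω ^ 2, by rw [← pow_mul, mul_comm, pow_mul, hω.pow_eq_one, one_pow], h⟩

theorem lemma10p1 :
    let k : TriangleGroup 3 3 4 := TriangleGroup.k 3 3 4
    let l : TriangleGroup 3 3 4 := TriangleGroup.l 3 3 4
    let Y : Set (ZariskiSpace (TriangleGroup 3 3 4)) :=
      closureIrreducibleCharacters (TriangleGroup 3 3 4) 3
    let ω : ℂ := Complex.exp (2 * Real.pi * Complex.I / 3)
    ∃ (W : Set (ZariskiSpace (TriangleGroup 3 3 4)))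
      (p : Fin 3 → ZariskiSpace (TriangleGroup 3 3 4)),
      -- `W` is a component of dimension two; the rest of `Y` is three isolated points
      IsComponentOf W Y ∧
      topologicalKrullDim W = 2 ∧
      Function.Injective p ∧
      (∀ i, p i ∉ W ∧ IsIsolatedPointOf (p i) Y) ∧
      Y = W ∪ Set.range p ∧
      -- the parameters define an isomorphism of `W` onto the hypersurface
      (∃ Φ : W ≃ hypersurfaceD334,
        IsRegularMap Φ ∧ IsRegularMap Φ.symm ∧
        ∀ χ : W, (Φ χ : ZariskiSpace (Fin 3)) = parametersD334 χ) ∧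
      -- the values of the characters in `W`
      (∀ χ ∈ W, χ k = 0 ∧ χ k⁻¹ = 0 ∧ χ l = 0 ∧ χ l⁻¹ = 0 ∧
        χ (k * l) = 1 ∧ χ (k * l)⁻¹ = 1) ∧
      -- the reducible characters in `W`
      (∀ χ ∈ W, χ ∉ irreducibleCharacters (TriangleGroup 3 3 4) 3 ↔
        parametersD334 χ = ![2, 2, 1] ∨
        parametersD334 χ = ![2 * ω, 2 * ω ^ 2, 1] ∨
        parametersD334 χ = ![2 * ω ^ 2, 2 * ω, 1]) := by

  intro k l Y ω
  have hω : IsPrimitiveRoot ω 3 := by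
    have := Complex.isPrimitiveRoot_exp 3 (by norm_num)
    rwa [Nat.cast_ofNat] at this
  refine ⟨componentD334, exceptionalCharacter, isComponentOf_componentD334,
    topologicalKrullDim_componentD334, exceptionalCharacter_injective,
    fun i => ⟨exceptionalCharacter_notMem i, isIsolatedPointOf_exceptionalCharacter i⟩,
    closureIrreducibleCharacters_eq, ⟨componentEquivD334, isRegularMap_componentEquivD334,
      isRegularMap_componentEquivD334_symm, fun _ => rfl⟩, fun χ hχ => hχ.2, fun χ hχ => ?_⟩
  -- For the cube root `c = ω ^ 2` this puts `2 * c ^ 2` into the form `2 * ω` of the third point.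
  have h4 : (ω ^ 2) ^ 2 = ω := by linear_combination ω * hω.pow_eq_one
  rw [notMem_irreducibleCharacters_iff hχ, exists_cube_eq_one_iff hω, h4, one_pow, mul_one]
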